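/- **Proposition.** Let $\mathcal C$ be a small category with finite products and let $D$ be a topological modal doctrine on $\mathcal C$. Then the syntactic category $\mathsf{Synt}_{S4}(D)$, with the factorization system $(\mathcal E,\mathcal M)$ and the operators $\Diamond_\varphi$ described below, is a topological modal category (in particular, it is an f-Boolean category). *Doctrines.* A Boolean doctrine on $\mathcal C$ is a functor $D:\mathcal C^{op}\to\mathbf{BoolAlg}$ such that each $f^{-1}:=D(f)$ has a left adjoint $\exists_f$, Frobenius reciprocity $\exists_f(f^{-1}\varphi\wedge\psi)=\varphi\wedge\exists_f\psi$ holds, and for all $f:Y\to Z$ and all $X$ the Beck–Chevalley conditions $f^{-1}\exists_{\pi_Z}=\exists_{\pi_Y}(X\times f)^{-1}$ and $(X\times X\times f)^{-1}\exists_{\Delta_X\times Z}=\exists_{\Delta_X\times Y}(X\times f)^{-1}$ hold. Equality on $X$ is $\exists_{\Delta_X}\top\in D(X\times X)$. A relation from $X$ to $Y$ is an $R\in D(X\times Y)$; composites, products, converses $R^{-1}$, and direct images $RA=\exists_{\pi_Y}(R\wedge\pi_X^{-1}A)$ are as usual; $\mathrm{dom}(R)=\exists_{\pi_X}R$ and $\mathrm{im}(R)=\exists_{\pi_Y}R$.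 A partial map $X\rightharpoonup Y$ is a relation with $R(x,y)\wedge R(x,y')\vdash y=y'$. *Loops.* A loop with anchor $X$ is a finite sequence $R_1,\dots,R_n$ of relations such that $R_1\circ\cdots\circ R_n$ is defined and goes from $X$ to $X$. Given a class $K$ of partial maps, acceptable loops are generated by: empty loops; insertion of an identity relation anywhere; concatenation of acceptable loops with the same anchor; $f,w,f^{-1}$ for $w$ acceptable and $f\in K$ with domain object the anchor of $w$; and $R_1\times S_1,\dots,R_n\times S_n$ for acceptable $R_1,\dots,R_n$ and $S_1,\dots,S_n$. Loop contraction (LC) says $\Diamond R_1\Diamond R_2\cdots\Diamond R_nA\le\Diamond A$ for every acceptable loop and every predicate $A$ on its anchor. Product independence (PI) says $\pi_X^{-1}\Diamond A\wedge\pi_Y^{-1}\Diamond B\le\Diamond(\pi_X^{-1}A\wedge\pi_Y^{-1}B)$. A topological modal doctrine is a Boolean doctrine with, on each $D(X)$, an operator $\Diamond$ preserving finite joins with $A\le\Diamond A=\Diamond\Diamond A$ and $\Diamond f^{-1}A\le f^{-1}\Diamond A$ for all $f$ in $\mathcal C$, satisfying (PI), together with a distinguished class $\mathcal C(D)$ of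 partial maps, closed under composition and products and containing the graphs of all morphisms of $\mathcal C$, such that (LC) holds for the acceptable loops built from $K=\mathcal C(D)$. *Syntactic category.* The objects are the pairs $(X,\varphi)$ with $\varphi\in D(X)$. A map $\varphi\to\psi$ (with $\psi\in D(Y)$) is a partial map $f:X\rightharpoonup Y$ with $\mathrm{dom}(f)=\varphi$ and $\mathrm{im}(f)\le\psi$; it is continuous if $f=\pi_X^{-1}\varphi\wedge R$ for some $R\in\mathcal C(D)$ with $\varphi\le\mathrm{dom}(R)$. Maps, composed as relations, form the syntactic Boolean category of $D$, and $\mathsf{Synt}_{S4}(D)$ is its wide subcategory of continuous maps. $\mathcal E$ is the class of continuous maps $f:\varphi\to\psi$ with $\mathrm{im}(f)=\psi$. $\mathcal M$ is the closure under isomorphism in $\mathsf{Synt}_{S4}(D)$ of the restrictions $\varphi\to\psi$ of identities $\mathrm{id}_X$, for $\varphi\le\psi$ in $D(X)$. *The claim in detail.* 1. $\mathsf{Synt}_{S4}(D)$ is f-Boolean: it has finite limits; $(\mathcal E,\mathcal M)$ is an orthogonal factorization system, both classes of which are stable under pullback; $\mathcal M$ consists of monomorphisms and contains all regular monomorphisms;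 each poset $\mathrm{Sub}(\varphi)$ of $\mathcal M$-subobjects is a Boolean algebra; and pullback along every morphism is a morphism of Boolean algebras. 2. For each object $\varphi$ with $\varphi\in D(X)$, sending $\psi\le\varphi$ to the class of the restriction $\psi\to\varphi$ of $\mathrm{id}_X$ is an isomorphism of posets ${\downarrow}\varphi\cong\mathrm{Sub}(\varphi)$. 3. Transporting $\Diamond_\varphi\psi=\varphi\wedge\Diamond_X\psi$ along these isomorphisms yields operators $\Diamond$ on the $\mathrm{Sub}(\varphi)$ that make $\mathsf{Synt}_{S4}(D)$ a topological modal category: they preserve finite joins; $\Diamond f^{-1}A\le f^{-1}\Diamond A$ for every morphism $f$; $\Diamond A=m^{-1}\Diamond\exists_mA$ for every $m\in\mathcal M$ (where $\exists_m$ is direct image for the factorization system); $A\le\Diamond A=\Diamond\Diamond A$; (PI) holds; and (LC) holds for all acceptable loops of relations (elements of $\mathrm{Sub}(\varphi\times\psi)$) with $K$ the class of all partial maps, that is, of all graphs $(d,t):\alpha\to\varphi\times\psi$ with $d:\alpha\to\varphi$ in $\mathcal M$ and $t:\alpha\to\psi$ any morphism. -/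

import Mathlib

open CategoryTheory CategoryTheory.Limits Opposite

universe w v u

set_option linter.unusedSimpArgs false

noncomputable section

/-! ## Predicates with existential quantification, and their relations -/

/-- A contravariant functor to Boolean algebras, together with a left adjoint `ex f` of each
reindexing map. -/
structure ExistentialDoctrine (C : Type u) [Category.{v} C] where
  fib : Cᵒᵖ ⥤ BoolAlg.{w}
  ex : ∀ {X Y : C}, (X ⟶ Y) → fib.obj (op X) → fib.obj (op Y)
  gc : ∀ {X Y : C} (f : X ⟶ Y), GaloisConnection (ex f) (fun A => fib.map f.op A)

namespace ExistentialDoctrine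

variable {C : Type u} [Category.{v} C] (P : ExistentialDoctrine.{w} C)

/-- The predicates on `X`. -/
abbrev Pred (X : C) : Type w := P.fib.obj (op X)

/-- Reindexing, `f⁻¹ A`. -/
def pull {X Y : C} (f : X ⟶ Y) (A : P.Pred Y) : P.Pred X := P.fib.map f.op A

variable [HasFiniteProducts C]

/-- The equality relation on `X`: the image of `⊤` under the diagonal. -/
def idRel (X : C) : P.Pred (X ⨯ X) := P.ex (diag X) ⊤

/-- The reciprocal relation. -/
def conv {X Y : C} (R : P.Pred (X ⨯ Y)) : P.Pred (Y ⨯ X) := P.pull (prod.lift prod.snd prod.fst) R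

/-- The composite relation `∃ y, R(x,y) ∧ S(y,z)` (first `R`, then `S`). -/
def relComp {X Y Z : C} (R : P.Pred (X ⨯ Y)) (S : P.Pred (Y ⨯ Z)) : P.Pred (X ⨯ Z) :=
  P.ex (prod.snd : Y ⨯ (X ⨯ Z) ⟶ X ⨯ Z)
    (P.pull (prod.lift (prod.snd ≫ prod.fst) prod.fst) R ⊓
      P.pull (prod.lift prod.fst (prod.snd ≫ prod.snd)) S)

/-- The product relation `R(x,y) ∧ S(x',y')`. -/
def relProd {X Y X' Y' : C} (R : P.Pred (X ⨯ Y)) (S : P.Pred (X' ⨯ Y')) :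
    P.Pred ((X ⨯ X') ⨯ (Y ⨯ Y')) :=
  P.pull (prod.map prod.fst prod.fst) R ⊓ P.pull (prod.map prod.snd prod.snd) S

/-- The direct image `R A = π_Y[R ∧ π_X⁻¹ A]`. -/
def image {X Y : C} (R : P.Pred (X ⨯ Y)) (A : P.Pred X) : P.Pred Y :=
  P.ex prod.snd (R ⊓ P.pull prod.fst A)

/-- The domain of a relation. -/
def dom {X Y : C} (R : P.Pred (X ⨯ Y)) : P.Pred X := P.ex prod.fst R

/-- The range of a relation. -/
def im {X Y : C} (R : P.Pred (X ⨯ Y)) : P.Pred Y := P.ex prod.snd R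

/-- The graph `f(x) = y` of a morphism. -/
def graph {X Y : C} (f : X ⟶ Y) : P.Pred (X ⨯ Y) := P.pull (prod.map f (𝟙 Y)) (P.idRel Y)

/-- `R(x,y) ∧ R(x,y') ⊢ y = y'`. -/
def IsFunctional {X Y : C} (R : P.Pred (X ⨯ Y)) : Prop :=
  P.pull (prod.lift prod.fst (prod.snd ≫ prod.fst) : X ⨯ (Y ⨯ Y) ⟶ X ⨯ Y) R ⊓
    P.pull (prod.lift prod.fst (prod.snd ≫ prod.snd) : X ⨯ (Y ⨯ Y) ⟶ X ⨯ Y) R ≤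
  P.pull (prod.snd : X ⨯ (Y ⨯ Y) ⟶ Y ⨯ Y) (P.idRel Y)

/-- Composable sequences `R₁, …, Rₙ` of relations, where `Rₙ` has domain `X`, `R₁` has
codomain `Z`, and the codomain of `Rᵢ₊₁` is the domain of `Rᵢ`. -/
inductive RelSeq : C → C → Type (max u w)
  | nil (X : C) : RelSeq X X
  | cons {X Y Z : C} (R : P.Pred (Y ⨯ Z)) (s : RelSeq X Y) : RelSeq X Z

variable {P}

/-- Concatenation of sequences. -/
def RelSeq.append {X Y Z : C} : P.RelSeq Y Z → P.RelSeq X Y → P.RelSeq X Z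
  | .nil _, t => t
  | .cons R s, t => .cons R (s.append t)

/-- `IsProd s t r`: `s = R₁, …, Rₙ` and `t = S₁, …, Sₙ` have the same length, and
`r = R₁ × S₁, …, Rₙ × Sₙ`. -/
inductive RelSeq.IsProd : ∀ {X Y X' Y' : C},
    P.RelSeq X Y → P.RelSeq X' Y' → P.RelSeq (X ⨯ X') (Y ⨯ Y') → Prop
  | nil (X X' : C) : IsProd (.nil X) (.nil X') (.nil (X ⨯ X'))
  | cons {X Y Z X' Y' Z' : C} (R : P.Pred (Y ⨯ Z)) (S : P.Pred (Y' ⨯ Z'))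
      {s : P.RelSeq X Y} {t : P.RelSeq X' Y'} {r : P.RelSeq (X ⨯ X') (Y ⨯ Y')} :
      IsProd s t r → IsProd (.cons R s) (.cons S t) (.cons (P.relProd R S) r)

/-- Acceptable loops, where `K` is the class of partial maps that may be used. -/
inductive RelSeq.Acceptable (K : ∀ X Y : C, Set (P.Pred (X ⨯ Y))) : ∀ {X : C}, P.RelSeq X X → Prop
  | nil (X : C) : Acceptable K (.nil X)
  | insert_id {X Y : C} (s : P.RelSeq Y X) (t : P.RelSeq X Y) :
      Acceptable K (s.append t) → Acceptable K (s.append (.cons (P.idRel Y) t))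
  | append {X : C} (s t : P.RelSeq X X) :
      Acceptable K s → Acceptable K t → Acceptable K (s.append t)
  | conj {X Y : C} (f : P.Pred (X ⨯ Y)) (s : P.RelSeq X X) : f ∈ K X Y → Acceptable K s →
      Acceptable K (.cons f (s.append (.cons (P.conv f) (.nil Y))))
  | prod {X Y : C} {s : P.RelSeq X X} {t : P.RelSeq Y Y} {r : P.RelSeq (X ⨯ Y) (X ⨯ Y)} :
      Acceptable K s → Acceptable K t → RelSeq.IsProd s t r → Acceptable K r

/-- `◇ R₁ ◇ R₂ ◇ ⋯ ◇ Rₙ A`. -/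
def RelSeq.eval (dia : ∀ X : C, P.Pred X → P.Pred X) {X Y : C} : P.RelSeq X Y → P.Pred X → P.Pred Y
  | .nil _, A => A
  | .cons (Z := Z) R s, A => dia Z (P.image R (s.eval dia A))

variable (P)

/-- The loop contraction axiom for all acceptable loops. -/
def LoopContraction (dia : ∀ X : C, P.Pred X → P.Pred X) (K : ∀ X Y : C, Set (P.Pred (X ⨯ Y))) :
    Prop :=
  ∀ (X : C) (s : P.RelSeq X X), s.Acceptable K → ∀ A : P.Pred X, s.eval dia A ≤ dia X A

/-- The product independence axiom. -/
def ProductIndependence (dia : ∀ X : C, P.Pred X → P.Pred X) : Prop :=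
  ∀ (X Y : C) (A : P.Pred X) (B : P.Pred Y),
    P.pull (prod.fst : X ⨯ Y ⟶ X) (dia X A) ⊓ P.pull (prod.snd : X ⨯ Y ⟶ Y) (dia Y B) ≤
      dia (X ⨯ Y) (P.pull prod.fst A ⊓ P.pull prod.snd B)

end ExistentialDoctrine

/-! ## Boolean doctrines and topological modal doctrines -/

structure BooleanDoctrine (C : Type u) [Category.{v} C] [HasFiniteProducts C] extends
    ExistentialDoctrine.{w} C where
  frobenius : ∀ {X Y : C} (f : X ⟶ Y) (A : toExistentialDoctrine.Pred Y)
    (B : toExistentialDoctrine.Pred X),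
    ex f (toExistentialDoctrine.pull f A ⊓ B) = A ⊓ ex f B
  bc_proj : ∀ (X : C) {Y Z : C} (f : Y ⟶ Z) (A : toExistentialDoctrine.Pred (X ⨯ Z)),
    toExistentialDoctrine.pull f (ex prod.snd A) =
      ex prod.snd (toExistentialDoctrine.pull (prod.map (𝟙 X) f) A)
  bc_diag : ∀ (X : C) {Y Z : C} (f : Y ⟶ Z) (A : toExistentialDoctrine.Pred (X ⨯ Z)),
    toExistentialDoctrine.pull (prod.map (𝟙 (X ⨯ X)) f) (ex (prod.map (diag X) (𝟙 Z)) A) =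
      ex (prod.map (diag X) (𝟙 Y)) (toExistentialDoctrine.pull (prod.map (𝟙 X) f) A)

/-- The fields `dia_bot` to `lax` say that the doctrine is a functor to S4 modal algebras and lax
morphisms. The set `cont X Y` consists of the distinguished partial maps from `X` to `Y`. -/
structure TopologicalModalDoctrine (C : Type u) [Category.{v} C] [HasFiniteProducts C] extends
    BooleanDoctrine.{w} C where
  dia : ∀ X : C, toExistentialDoctrine.Pred X → toExistentialDoctrine.Pred X
  dia_bot : ∀ X : C, dia X ⊥ = ⊥
  dia_sup : ∀ (X : C) (A B : toExistentialDoctrine.Pred X), dia X (A ⊔ B) = dia X A ⊔ dia X B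
  le_dia : ∀ (X : C) (A : toExistentialDoctrine.Pred X), A ≤ dia X A
  dia_dia : ∀ (X : C) (A : toExistentialDoctrine.Pred X), dia X (dia X A) = dia X A
  lax : ∀ {X Y : C} (f : X ⟶ Y) (A : toExistentialDoctrine.Pred Y),
    dia X (toExistentialDoctrine.pull f A) ≤ toExistentialDoctrine.pull f (dia Y A)
  product_independence : toExistentialDoctrine.ProductIndependence dia
  cont : ∀ X Y : C, Set (toExistentialDoctrine.Pred (X ⨯ Y))
  cont_functional : ∀ {X Y : C}, ∀ R ∈ cont X Y, toExistentialDoctrine.IsFunctional R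
  cont_graph : ∀ {X Y : C} (f : X ⟶ Y), toExistentialDoctrine.graph f ∈ cont X Y
  cont_comp : ∀ {X Y Z : C}, ∀ R ∈ cont X Y, ∀ S ∈ cont Y Z,
    toExistentialDoctrine.relComp R S ∈ cont X Z
  cont_prod : ∀ {X Y X' Y' : C}, ∀ R ∈ cont X Y, ∀ S ∈ cont X' Y',
    toExistentialDoctrine.relProd R S ∈ cont (X ⨯ X') (Y ⨯ Y')
  loop_contraction : toExistentialDoctrine.LoopContraction dia cont

/-! ## Internal logic of a Boolean doctrine -/

namespace BooleanDoctrine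

variable {C : Type u} [Category.{v} C] [HasFiniteProducts C] (P : BooleanDoctrine.{w} C)

/-- `R(f, g)` in a context `W`. -/
def ev {W X Y : C} (R : P.Pred (X ⨯ Y)) (f : W ⟶ X) (g : W ⟶ Y) : P.Pred W :=
  P.pull (prod.lift f g) R

theorem pull_id {X : C} (A : P.Pred X) : P.pull (𝟙 X) A = A := by
  simp [ExistentialDoctrine.pull]

theorem pull_pull {X Y Z : C} (f : X ⟶ Y) (g : Y ⟶ Z) (A : P.Pred Z) :
    P.pull f (P.pull g A) = P.pull (f ≫ g) A := by
  simp [ExistentialDoctrine.pull]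

theorem pull_inf {X Y : C} (f : X ⟶ Y) (A B : P.Pred Y) :
    P.pull f (A ⊓ B) = P.pull f A ⊓ P.pull f B :=
  map_inf (P.fib.map f.op).hom A B

theorem pull_himp {X Y : C} (f : X ⟶ Y) (A B : P.Pred Y) :
    P.pull f (A ⇨ B) = P.pull f A ⇨ P.pull f B :=
  map_himp (P.fib.map f.op).hom A B

theorem pull_top {X Y : C} (f : X ⟶ Y) : P.pull f (⊤ : P.Pred Y) = ⊤ :=
  map_top (P.fib.map f.op).hom

theorem pull_mono {X Y : C} (f : X ⟶ Y) {A B : P.Pred Y} (h : A ≤ B) : P.pull f A ≤ P.pull f B :=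
  OrderHomClass.mono (P.fib.map f.op).hom h

theorem ex_le_iff {X Y : C} (f : X ⟶ Y) (A : P.Pred X) (B : P.Pred Y) :
    P.ex f A ≤ B ↔ A ≤ P.pull f B := P.gc f A B

theorem le_pull_ex {X Y : C} (f : X ⟶ Y) (A : P.Pred X) : A ≤ P.pull f (P.ex f A) :=
  (P.gc f).le_u_l A

theorem pull_ev {V W X Y : C} (k : V ⟶ W) (R : P.Pred (X ⨯ Y)) (f : W ⟶ X) (g : W ⟶ Y) :
    P.pull k (P.ev R f g) = P.ev R (k ≫ f) (k ≫ g) := by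
  simp [ev, pull_pull]

theorem ev_inf {W X Y : C} (R S : P.Pred (X ⨯ Y)) (f : W ⟶ X) (g : W ⟶ Y) :
    P.ev (R ⊓ S) f g = P.ev R f g ⊓ P.ev S f g := P.pull_inf _ _ _

theorem ev_mono {W X Y : C} {R S : P.Pred (X ⨯ Y)} (h : R ≤ S) (f : W ⟶ X) (g : W ⟶ Y) :
    P.ev R f g ≤ P.ev S f g := P.pull_mono _ h

theorem ev_pull_fst {W X Y : C} (A : P.Pred X) (f : W ⟶ X) (g : W ⟶ Y) :
    P.ev (P.pull (prod.fst : X ⨯ Y ⟶ X) A) f g = P.pull f A := by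
  rw [ev, pull_pull, prod.lift_fst]

theorem ev_fst_snd {X Y : C} (R : P.Pred (X ⨯ Y)) : P.ev R prod.fst prod.snd = R := by
  simp [ev, pull_id]

theorem le_of_ev {X Y : C} {R S : P.Pred (X ⨯ Y)}
    (h : P.ev R prod.fst prod.snd ≤ P.ev S prod.fst prod.snd) : R ≤ S := by
  rwa [ev_fst_snd, ev_fst_snd] at h

/-- Introduction of `∃`. -/
theorem ex_snd_intro {W X : C} (R : P.Pred (X ⨯ W)) (t : W ⟶ X) :
    P.ev R t (𝟙 W) ≤ P.ex prod.snd R := by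
  have := P.pull_mono (prod.lift t (𝟙 W)) (P.le_pull_ex prod.snd R)
  rwa [pull_pull, prod.lift_snd, pull_id] at this

/-- Elimination of `∃`. -/
theorem ex_snd_elim {W X : C} {R : P.Pred (X ⨯ W)} {a b : P.Pred W} (h : a ≤ P.ex prod.snd R)
    (k : P.pull prod.snd a ⊓ R ≤ P.pull prod.snd b) : a ≤ b := by
  have h1 : P.ex prod.snd (P.pull prod.snd a ⊓ R) ≤ b := (P.ex_le_iff _ _ _).2 k
  rw [P.frobenius] at h1
  exact (le_inf le_rfl h).trans h1

theorem ev_relComp {W X Y Z : C} (R : P.Pred (X ⨯ Y)) (S : P.Pred (Y ⨯ Z)) (f : W ⟶ X)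
    (g : W ⟶ Z) : P.ev (P.relComp R S) f g =
      P.ex (prod.snd : Y ⨯ W ⟶ W)
        (P.ev R (prod.snd ≫ f) prod.fst ⊓ P.ev S prod.fst (prod.snd ≫ g)) := by
  rw [ev, ExistentialDoctrine.relComp, P.bc_proj, pull_inf, pull_pull, pull_pull]
  simp [ev, prod.lift_fst, prod.lift_snd, prod.lift_fst_assoc, prod.lift_snd_assoc]

theorem relComp_intro {W X Y Z : C} {R : P.Pred (X ⨯ Y)} {S : P.Pred (Y ⨯ Z)} {a : P.Pred W}
    {f : W ⟶ X} {g : W ⟶ Z} (t : W ⟶ Y) (h : a ≤ P.ev R f t) (k : a ≤ P.ev S t g) :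
    a ≤ P.ev (P.relComp R S) f g := by
  rw [ev_relComp]
  refine le_trans (le_inf h k) (le_trans (le_of_eq ?_) (P.ex_snd_intro _ t))
  rw [ev_inf]
  simp [ev, pull_pull, prod.lift_fst, prod.lift_snd, prod.lift_fst_assoc, prod.lift_snd_assoc]

theorem relComp_elim {W X Y Z : C} {R : P.Pred (X ⨯ Y)} {S : P.Pred (Y ⨯ Z)} {a b : P.Pred W}
    {f : W ⟶ X} {g : W ⟶ Z} (h : a ≤ P.ev (P.relComp R S) f g)
    (k : P.pull prod.snd a ⊓
      (P.ev R (prod.snd ≫ f) prod.fst ⊓ P.ev S prod.fst (prod.snd ≫ g)) ≤ P.pull prod.snd b) :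
    a ≤ b := by
  rw [ev_relComp] at h
  exact P.ex_snd_elim h k

theorem pull_im {W X Y : C} (R : P.Pred (X ⨯ Y)) (g : W ⟶ Y) :
    P.pull g (P.im R) = P.ex (prod.snd : X ⨯ W ⟶ W) (P.ev R prod.fst (prod.snd ≫ g)) := by
  rw [ExistentialDoctrine.im, P.bc_proj, ev]
  congr 2
  ext <;> simp [prod.lift_fst, prod.lift_snd, prod.lift_fst_assoc, prod.lift_snd_assoc]

theorem im_intro {W X Y : C} {R : P.Pred (X ⨯ Y)} {a : P.Pred W} {g : W ⟶ Y} (t : W ⟶ X)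
    (h : a ≤ P.ev R t g) : a ≤ P.pull g (P.im R) := by
  rw [pull_im]
  refine h.trans (le_trans (le_of_eq ?_) (P.ex_snd_intro _ t))
  simp [ev, pull_pull, prod.lift_fst, prod.lift_snd, prod.lift_fst_assoc, prod.lift_snd_assoc]

theorem im_elim {W X Y : C} {R : P.Pred (X ⨯ Y)} {a b : P.Pred W} {g : W ⟶ Y}
    (h : a ≤ P.pull g (P.im R))
    (k : P.pull prod.snd a ⊓ P.ev R prod.fst (prod.snd ≫ g) ≤ P.pull prod.snd b) : a ≤ b := by
  rw [pull_im] at h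
  exact P.ex_snd_elim h k

theorem ev_conv {W X Y : C} (R : P.Pred (X ⨯ Y)) (f : W ⟶ X) (g : W ⟶ Y) :
    P.ev (P.conv R) g f = P.ev R f g := by
  simp [ev, ExistentialDoctrine.conv, pull_pull, prod.lift_fst, prod.lift_snd, prod.lift_fst_assoc, prod.lift_snd_assoc]

theorem dom_eq_im_conv {X Y : C} (R : P.Pred (X ⨯ Y)) : P.dom R = P.im (P.conv R) := by
  apply le_antisymm
  · rw [ExistentialDoctrine.dom, ex_le_iff]
    refine P.im_intro prod.snd ?_
    rw [ev_conv, ev_fst_snd]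
  · rw [ExistentialDoctrine.im, ex_le_iff]
    have := P.pull_mono (prod.lift prod.snd prod.fst : Y ⨯ X ⟶ X ⨯ Y) (P.le_pull_ex prod.fst R)
    rwa [pull_pull, prod.lift_fst] at this

theorem dom_intro {W X Y : C} {R : P.Pred (X ⨯ Y)} {a : P.Pred W} {f : W ⟶ X} (t : W ⟶ Y)
    (h : a ≤ P.ev R f t) : a ≤ P.pull f (P.dom R) := by
  rw [dom_eq_im_conv]
  exact P.im_intro t (by rwa [ev_conv])

theorem dom_elim {W X Y : C} {R : P.Pred (X ⨯ Y)} {a b : P.Pred W} {f : W ⟶ X}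
    (h : a ≤ P.pull f (P.dom R))
    (k : P.pull prod.snd a ⊓ P.ev R (prod.snd ≫ f) prod.fst ≤ P.pull prod.snd b) : a ≤ b := by
  rw [dom_eq_im_conv] at h
  exact P.im_elim h (by rwa [ev_conv])

theorem eq_refl {W X : C} (a : P.Pred W) (f : W ⟶ X) : a ≤ P.ev (P.idRel X) f f := by
  have := P.pull_mono f (P.le_pull_ex (diag X) ⊤)
  rw [pull_top, pull_pull] at this
  refine le_top.trans (this.trans (le_of_eq ?_))
  rw [ev, ExistentialDoctrine.idRel]
  congr 1
  ext <;> simp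

theorem pull_idRel_le (X Y : C) :
    P.pull (prod.fst : (X ⨯ X) ⨯ Y ⟶ X ⨯ X) (P.idRel X) ≤ P.ex (prod.map (diag X) (𝟙 Y)) ⊤ := by
  have h := P.bc_diag X (terminal.from Y) ⊤
  rw [pull_top] at h
  rw [← h]
  have h1 : P.idRel X ≤ P.pull (prod.lift (𝟙 (X ⨯ X)) (terminal.from _))
      (P.ex (prod.map (diag X) (𝟙 (⊤_ C))) ⊤) := by
    rw [ExistentialDoctrine.idRel, ex_le_iff, pull_pull]
    have h2 : diag X ≫ prod.lift (𝟙 (X ⨯ X)) (terminal.from _) =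
        prod.lift (𝟙 X) (terminal.from X) ≫ prod.map (diag X) (𝟙 (⊤_ C)) := by
      ext <;> simp
    rw [h2, ← pull_pull]
    refine le_trans (le_of_eq ?_) (P.pull_mono _ (P.le_pull_ex _ _))
    rw [pull_top]
  refine (P.pull_mono _ h1).trans (le_of_eq ?_)
  rw [pull_pull]
  congr 1
  ext <;> simp [prod.lift_fst, prod.lift_snd, prod.lift_fst_assoc, prod.lift_snd_assoc]

theorem eq_subst {W X Y : C} (R : P.Pred (X ⨯ Y)) {a : P.Pred W} {f g : W ⟶ X} {h : W ⟶ Y}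
    (h1 : a ≤ P.ev (P.idRel X) f g) (h2 : a ≤ P.ev R f h) : a ≤ P.ev R g h := by
  have key : P.pull (prod.fst : (X ⨯ X) ⨯ Y ⟶ X ⨯ X) (P.idRel X) ≤
      P.ev R (prod.fst ≫ prod.fst) prod.snd ⇨ P.ev R (prod.fst ≫ prod.snd) prod.snd := by
    refine (P.pull_idRel_le X Y).trans ?_
    rw [ex_le_iff, pull_himp, pull_ev, pull_ev]
    simp [prod.lift_fst, prod.lift_snd, prod.lift_fst_assoc, prod.lift_snd_assoc]
  have := P.pull_mono (prod.lift (prod.lift f g) h) key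
  rw [pull_himp, pull_ev, pull_ev, pull_pull] at this
  simp only [prod.lift_fst_assoc, prod.lift_fst, prod.lift_snd] at this
  rw [le_himp_iff] at this
  exact (le_inf h1 h2).trans this

theorem eq_symm {W X : C} {a : P.Pred W} {f g : W ⟶ X}
    (h1 : a ≤ P.ev (P.idRel X) f g) : a ≤ P.ev (P.idRel X) g f :=
  P.eq_subst _ h1 (P.eq_refl a f)

theorem eq_subst_right {W X Y : C} (R : P.Pred (X ⨯ Y)) {a : P.Pred W} {f g : W ⟶ Y} {h : W ⟶ X}
    (h1 : a ≤ P.ev (P.idRel Y) f g) (h2 : a ≤ P.ev R h f) : a ≤ P.ev R h g := by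
  rw [← ev_conv] at h2 ⊢
  exact P.eq_subst _ h1 h2

theorem eq_subst_pred {W X : C} (A : P.Pred X) {a : P.Pred W} {f g : W ⟶ X}
    (h1 : a ≤ P.ev (P.idRel X) f g) (h2 : a ≤ P.pull f A) : a ≤ P.pull g A := by
  rw [← P.ev_pull_fst A g g]
  exact P.eq_subst _ h1 (by rwa [P.ev_pull_fst])

theorem functional_elim {W X Y : C} {R : P.Pred (X ⨯ Y)} (hR : P.IsFunctional R) {a : P.Pred W}
    {f : W ⟶ X} {g h : W ⟶ Y} (h1 : a ≤ P.ev R f g) (h2 : a ≤ P.ev R f h) :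
    a ≤ P.ev (P.idRel Y) g h := by
  have := P.pull_mono (prod.lift f (prod.lift g h)) hR
  rw [pull_inf, pull_pull, pull_pull, pull_pull] at this
  simp only [prod.comp_lift, prod.lift_fst, prod.lift_snd, prod.lift_snd_assoc] at this
  exact (le_inf h1 h2).trans this

theorem functional_intro {X Y : C} {R : P.Pred (X ⨯ Y)}
    (h : ∀ {W : C} (a : P.Pred W) (f : W ⟶ X) (g h : W ⟶ Y), a ≤ P.ev R f g → a ≤ P.ev R f h →
      a ≤ P.ev (P.idRel Y) g h) : P.IsFunctional R := by
  refine (h _ prod.fst (prod.snd ≫ prod.fst) (prod.snd ≫ prod.snd) inf_le_left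
    inf_le_right).trans (le_of_eq ?_)
  rw [ev]
  congr 1
  ext <;> simp [prod.lift_fst, prod.lift_snd]

theorem le_pull_of_im_le {W X Y : C} {R : P.Pred (X ⨯ Y)} {B : P.Pred Y} (h : P.im R ≤ B)
    {a : P.Pred W} {f : W ⟶ X} {g : W ⟶ Y} (h1 : a ≤ P.ev R f g) : a ≤ P.pull g B :=
  (P.im_intro f h1).trans (P.pull_mono g h)

theorem le_pull_of_dom_le {W X Y : C} {R : P.Pred (X ⨯ Y)} {A : P.Pred X} (h : P.dom R ≤ A)
    {a : P.Pred W} {f : W ⟶ X} {g : W ⟶ Y} (h1 : a ≤ P.ev R f g) : a ≤ P.pull f A :=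
  (P.dom_intro g h1).trans (P.pull_mono f h)

theorem im_le {X Y : C} {R : P.Pred (X ⨯ Y)} {B : P.Pred Y} (h : R ≤ P.pull prod.snd B) :
    P.im R ≤ B := (P.ex_le_iff _ _ _).2 h

theorem dom_le {X Y : C} {R : P.Pred (X ⨯ Y)} {A : P.Pred X} (h : R ≤ P.pull prod.fst A) :
    P.dom R ≤ A := (P.ex_le_iff _ _ _).2 h

theorem dom_mono {X Y : C} {R S : P.Pred (X ⨯ Y)} (h : R ≤ S) : P.dom R ≤ P.dom S :=
  (P.gc _).monotone_l h

theorem relComp_mono {X Y Z : C} {R R' : P.Pred (X ⨯ Y)} {S S' : P.Pred (Y ⨯ Z)} (h : R ≤ R')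
    (k : S ≤ S') : P.relComp R S ≤ P.relComp R' S' :=
  (P.gc _).monotone_l (inf_le_inf (P.pull_mono _ h) (P.pull_mono _ k))

theorem ev_elim {X Y : C} {R S : P.Pred (X ⨯ Y)}
    (h : ∀ {W : C} (a : P.Pred W) (f : W ⟶ X) (g : W ⟶ Y), a ≤ P.ev R f g → a ≤ P.ev S f g) :
    R ≤ S :=
  P.le_of_ev (h _ _ _ le_rfl)

theorem relComp_assoc {X Y Z T : C} (R : P.Pred (X ⨯ Y)) (S : P.Pred (Y ⨯ Z)) (Q : P.Pred (Z ⨯ T)) :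
    P.relComp (P.relComp R S) Q = P.relComp R (P.relComp S Q) := by
  apply le_antisymm
  · refine P.ev_elim fun a f g h => P.relComp_elim h ?_
    refine P.relComp_elim (inf_le_right.trans inf_le_left) ?_
    rw [pull_ev, pull_ev]
    refine P.relComp_intro prod.fst (inf_le_right.trans inf_le_left) ?_
    refine P.relComp_intro (prod.snd ≫ prod.fst) (inf_le_right.trans inf_le_right) ?_
    rw [pull_inf, pull_inf, pull_ev]
    refine inf_le_left.trans (inf_le_right.trans (inf_le_right.trans (le_of_eq ?_)))
    rw [pull_ev]
  · refine P.ev_elim fun a f g h => P.relComp_elim h ?_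
    refine P.relComp_elim (inf_le_right.trans inf_le_right) ?_
    rw [pull_ev, pull_ev]
    refine P.relComp_intro prod.fst ?_ (inf_le_right.trans inf_le_right)
    refine P.relComp_intro (prod.snd ≫ prod.fst) ?_ (inf_le_right.trans inf_le_left)
    rw [pull_inf, pull_inf, pull_ev]
    exact inf_le_left.trans (inf_le_right.trans inf_le_left)

/-- The restriction of a relation to `A`. -/
def restrict {X Y : C} (R : P.Pred (X ⨯ Y)) (A : P.Pred X) : P.Pred (X ⨯ Y) :=
  P.pull prod.fst A ⊓ R

theorem ev_restrict {W X Y : C} (R : P.Pred (X ⨯ Y)) (A : P.Pred X) (f : W ⟶ X) (g : W ⟶ Y) :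
    P.ev (P.restrict R A) f g = P.pull f A ⊓ P.ev R f g := by
  rw [restrict, ev_inf, ev_pull_fst]

theorem restrict_id_functional {X : C} (A : P.Pred X) :
    P.IsFunctional (P.restrict (P.idRel X) A) := by
  refine P.functional_intro fun a f g h h1 h2 => ?_
  rw [ev_restrict] at h1 h2
  exact P.eq_subst _ (h1.trans inf_le_right) (h2.trans inf_le_right)

theorem dom_restrict_id {X : C} (A : P.Pred X) : P.dom (P.restrict (P.idRel X) A) = A := by
  apply le_antisymm
  · exact P.dom_le inf_le_left
  · have : A ≤ P.pull (𝟙 X) (P.dom (P.restrict (P.idRel X) A)) := by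
      refine P.dom_intro (𝟙 X) ?_
      rw [ev_restrict, pull_id]
      exact le_inf le_rfl (P.eq_refl _ _)
    rwa [pull_id] at this

theorem im_restrict_id_le {X : C} (A : P.Pred X) : P.im (P.restrict (P.idRel X) A) ≤ A := by
  refine P.im_le ?_
  refine P.eq_subst_pred A (f := prod.fst) ?_ inf_le_left
  rw [ev_fst_snd]
  exact inf_le_right

theorem relComp_restrict_id {X Y : C} {R : P.Pred (X ⨯ Y)} {B : P.Pred Y} (h : P.im R ≤ B) :
    P.relComp R (P.restrict (P.idRel Y) B) = R := by
  apply le_antisymm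
  · refine P.ev_elim fun a f g h1 => P.relComp_elim h1 ?_
    rw [ev_restrict, pull_ev]
    exact P.eq_subst_right R (f := prod.fst) (inf_le_right.trans (inf_le_right.trans inf_le_right))
      (inf_le_right.trans inf_le_left)
  · refine P.ev_elim fun a f g h1 => P.relComp_intro g h1 ?_
    rw [ev_restrict]
    exact le_inf (P.le_pull_of_im_le h h1) (P.eq_refl _ _)

theorem restrict_id_relComp {X Y : C} {R : P.Pred (X ⨯ Y)} {A : P.Pred X} (h : P.dom R ≤ A) :
    P.relComp (P.restrict (P.idRel X) A) R = R := by
  apply le_antisymm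
  · refine P.ev_elim fun a f g h1 => P.relComp_elim h1 ?_
    rw [ev_restrict, pull_ev]
    exact P.eq_subst R (f := prod.fst)
      (P.eq_symm (inf_le_right.trans (inf_le_left.trans inf_le_right)))
      (inf_le_right.trans inf_le_right)
  · refine P.ev_elim fun a f g h1 => P.relComp_intro f ?_ h1
    rw [ev_restrict]
    exact le_inf (P.le_pull_of_dom_le h h1) (P.eq_refl _ _)

theorem functional_relComp {X Y Z : C} {R : P.Pred (X ⨯ Y)} {S : P.Pred (Y ⨯ Z)}
    (hR : P.IsFunctional R) (hS : P.IsFunctional S) : P.IsFunctional (P.relComp R S) := by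
  refine P.functional_intro fun a f g h h1 h2 => P.relComp_elim h1 ?_
  refine P.relComp_elim (R := R) (S := S) (f := prod.snd ≫ f) (g := prod.snd ≫ h) ?_ ?_
  · rw [← pull_ev]
    exact inf_le_left.trans (P.pull_mono _ h2)
  · rw [pull_ev, pull_ev]
    have e : ∀ {W : C} {a : P.Pred W} {x : W ⟶ X} {y y' : W ⟶ Y} {z z' : W ⟶ Z},
        a ≤ P.ev R x y → a ≤ P.ev S y z → a ≤ P.ev R x y' → a ≤ P.ev S y' z' →
          a ≤ P.ev (P.idRel Z) z z' := fun h1 h2 h3 h4 =>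
      P.functional_elim hS (P.eq_subst S (P.functional_elim hR h1 h3) h2) h4
    refine e (x := prod.snd ≫ prod.snd ≫ f) (y := prod.snd ≫ prod.fst) (y' := prod.fst) ?_ ?_
      (inf_le_right.trans inf_le_left) (inf_le_right.trans inf_le_right)
    · rw [pull_inf, pull_inf, pull_ev]
      exact inf_le_left.trans (inf_le_right.trans inf_le_left)
    · rw [pull_inf, pull_inf, pull_ev, pull_ev]
      exact inf_le_left.trans (inf_le_right.trans inf_le_right)

/-! ## The syntactic Boolean category -/

/-- Objects: the elements of the doctrine. -/
structure Synt where
  base : C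
  pred : P.Pred base

variable {P}

/-- The maps `φ ⟶ ψ`: functional relations with domain `φ` and range below `ψ`. -/
@[ext]
structure Synt.Hom (φ ψ : P.Synt) where
  rel : P.Pred (φ.base ⨯ ψ.base)
  functional : P.IsFunctional rel
  dom_eq : P.dom rel = φ.pred
  im_le : P.im rel ≤ ψ.pred

/-- The restriction of the identity of `X`, as a map `A ⟶ B` for `A ≤ B`. -/
def Synt.inclHom {X : C} {A B : P.Pred X} (h : A ≤ B) : Synt.Hom (P := P) ⟨X, A⟩ ⟨X, B⟩ where
  rel := P.restrict (P.idRel X) A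
  functional := P.restrict_id_functional A
  dom_eq := P.dom_restrict_id A
  im_le := (P.im_restrict_id_le A).trans h

def Synt.Hom.comp {φ ψ θ : P.Synt} (f : Synt.Hom φ ψ) (g : Synt.Hom ψ θ) : Synt.Hom φ θ where
  rel := P.relComp f.rel g.rel
  functional := P.functional_relComp f.functional g.functional
  dom_eq := by
    apply le_antisymm
    · refine P.dom_le ?_
      rw [← P.ev_fst_snd (P.relComp f.rel g.rel)]
      refine P.relComp_elim le_rfl ?_
      rw [P.pull_pull]
      exact P.le_pull_of_dom_le f.dom_eq.le (inf_le_right.trans inf_le_left)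
    · have : φ.pred ≤ P.pull (𝟙 φ.base) (P.dom (P.relComp f.rel g.rel)) := by
        refine P.dom_elim (R := f.rel) (f := 𝟙 _) (by rw [P.pull_id, f.dom_eq]) ?_
        refine P.dom_elim (R := g.rel) (f := prod.fst) ?_ ?_
        · rw [g.dom_eq]
          exact P.le_pull_of_im_le f.im_le inf_le_right
        · rw [P.pull_pull, P.pull_pull]
          refine P.dom_intro prod.fst (P.relComp_intro (prod.snd ≫ prod.fst) ?_ inf_le_right)
          rw [P.pull_inf, P.pull_ev]
          refine inf_le_left.trans (inf_le_right.trans (le_of_eq ?_))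
          simp
      rwa [P.pull_id] at this
  im_le := by
    refine P.im_le ?_
    rw [← P.ev_fst_snd (P.relComp f.rel g.rel)]
    refine P.relComp_elim le_rfl ?_
    rw [P.pull_pull]
    exact P.le_pull_of_im_le g.im_le (inf_le_right.trans inf_le_right)

instance : Category.{w} P.Synt where
  Hom := Synt.Hom
  id φ := Synt.inclHom (le_refl φ.pred)
  comp := Synt.Hom.comp
  id_comp f := Synt.Hom.ext (P.restrict_id_relComp f.dom_eq.le)
  comp_id f := Synt.Hom.ext (P.relComp_restrict_id f.im_le)
  assoc f g h := Synt.Hom.ext (P.relComp_assoc f.rel g.rel h.rel)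

end BooleanDoctrine

/-! ## The syntactic category of a topological modal doctrine -/

namespace TopologicalModalDoctrine

open BooleanDoctrine

variable {C : Type u} [Category.{v} C] [HasFiniteProducts C] (D : TopologicalModalDoctrine.{w} C)

/-- A map is continuous if it is the restriction of a distinguished partial map. -/
def continuous : MorphismProperty D.toBooleanDoctrine.Synt := fun φ ψ f =>
  ∃ R ∈ D.cont φ.base ψ.base, φ.pred ≤ D.dom R ∧
    Synt.Hom.rel f = D.toBooleanDoctrine.restrict R φ.pred

theorem idRel_mem_cont (X : C) : D.idRel X ∈ D.cont X X := by
  have h := D.cont_graph (𝟙 X)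
  rwa [ExistentialDoctrine.graph, prod.map_id_id, D.pull_id] at h

theorem inclHom_continuous {X : C} {A B : D.Pred X} (h : A ≤ B) :
    D.continuous (X := ⟨X, A⟩) (Y := ⟨X, B⟩) (Synt.inclHom h) := by
  refine ⟨D.idRel X, D.idRel_mem_cont X, ?_, rfl⟩
  exact (D.dom_restrict_id A).ge.trans (D.dom_mono inf_le_right)

instance : D.continuous.IsMultiplicative where
  id_mem φ := D.inclHom_continuous (le_refl φ.pred)
  comp_mem {φ ψ θ} f g := by
    rintro ⟨R, hR, hR1, hR2⟩ ⟨S, hS, hS1, hS2⟩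
    have hfR : Synt.Hom.rel f ≤ R := hR2.le.trans inf_le_right
    have hgS : Synt.Hom.rel g ≤ S := hS2.le.trans inf_le_right
    refine ⟨D.relComp R S, D.cont_comp R hR S hS, ?_, ?_⟩
    · exact (Synt.Hom.dom_eq (f ≫ g)).ge.trans (D.dom_mono (D.relComp_mono hfR hgS))
    · apply le_antisymm
      · refine le_inf ?_ (D.relComp_mono hfR hgS)
        exact (D.ex_le_iff _ _ _).1 (Synt.Hom.dom_eq (f ≫ g)).le
      · refine D.ev_elim fun a x z h => ?_
        rw [ev_restrict] at h
        refine D.relComp_elim (h.trans inf_le_right) ?_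
        rw [D.pull_ev]
        have h1 : D.pull prod.snd a ⊓ (D.ev R (prod.snd ≫ x) prod.fst ⊓
            D.ev S prod.fst (prod.snd ≫ z)) ≤
              D.ev (Synt.Hom.rel f) (prod.snd ≫ x) (prod.fst : ψ.base ⨯ _ ⟶ _) := by
          rw [hR2, ev_restrict, ← D.pull_pull]
          exact le_inf (inf_le_left.trans (D.pull_mono _ (h.trans inf_le_left)))
            (inf_le_right.trans inf_le_left)
        refine D.relComp_intro prod.fst h1 ?_
        rw [hS2, ev_restrict]
        exact le_inf (D.le_pull_of_im_le (Synt.Hom.im_le f) h1)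
          (inf_le_right.trans inf_le_right)

/-- The syntactic category: the wide subcategory of continuous maps. -/
abbrev SyntS4 := WideSubcategory D.continuous

/-- The element of the doctrine underlying an object, seen in the syntactic category. -/
abbrev SyntS4.of {X : C} (A : D.Pred X) : D.SyntS4 := ⟨⟨X, A⟩⟩

/-- The restriction of the identity of `X`, as a morphism `A ⟶ B` for `A ≤ B`. -/
def SyntS4.incl {X : C} {A B : D.Pred X} (h : A ≤ B) : SyntS4.of D A ⟶ SyntS4.of D B :=
  ⟨Synt.inclHom h, D.inclHom_continuous h⟩

instance {X : C} {A B : D.Pred X} (h : A ≤ B) : Mono (SyntS4.incl D h) where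
  right_cancellation {φ} f g e := by
    have e1 : D.relComp (Synt.Hom.rel f.hom) (D.toBooleanDoctrine.restrict (D.idRel X) A) =
        D.relComp (Synt.Hom.rel g.hom) (D.toBooleanDoctrine.restrict (D.idRel X) A) :=
      congrArg (fun k => Synt.Hom.rel k.hom) e
    have hf := D.relComp_restrict_id (R := Synt.Hom.rel f.hom) (Synt.Hom.im_le f.hom)
    have hg := D.relComp_restrict_id (R := Synt.Hom.rel g.hom) (Synt.Hom.im_le g.hom)
    exact WideSubcategory.hom_ext _ (Synt.Hom.ext (hf.symm.trans (e1.trans hg)))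

/-- The continuous surjections. -/
def surjections : MorphismProperty D.SyntS4 := fun _ ψ f =>
  D.im (Synt.Hom.rel f.hom) = ψ.obj.pred

/-- The restrictions of identities of objects of `C`. -/
inductive IsIncl : MorphismProperty D.SyntS4
  | incl {X : C} {A B : D.Pred X} (h : A ≤ B) : IsIncl (SyntS4.incl D h)

/-- The embeddings: morphisms isomorphic in the syntactic category to restrictions of
identities. -/
def embeddings : MorphismProperty D.SyntS4 := D.IsIncl.isoClosure

end TopologicalModalDoctrine

/-! ## f-Boolean categories and topological modal categories -/

/-- Orthogonal factorization systems with left class `L` and right class `M`. -/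
class IsOrthogonalFactorizationSystem {E : Type u} [Category.{v} E] (L M : MorphismProperty E) :
    Prop where
  left_isMultiplicative : L.IsMultiplicative
  left_respectsIso : L.RespectsIso
  right_isMultiplicative : M.IsMultiplicative
  right_respectsIso : M.RespectsIso
  hasFactorization : L.HasFactorization M
  existsUnique_lift : ∀ {A B X Y : E} (l : A ⟶ B) (m : X ⟶ Y) (f : A ⟶ X) (g : B ⟶ Y),
    L l → M m → f ≫ m = l ≫ g → ∃! d : B ⟶ X, l ≫ d = f ∧ d ≫ m = g

attribute [instance] IsOrthogonalFactorizationSystem.right_respectsIso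
  IsOrthogonalFactorizationSystem.hasFactorization

/-- Proper stable orthogonal factorization systems. -/
class IsProperStable {E : Type u} [Category.{v} E] (L M : MorphismProperty E) : Prop extends
    IsOrthogonalFactorizationSystem L M where
  mono : ∀ {X Y : E} (m : X ⟶ Y), M m → Mono m
  regularMono : ∀ {X Y : E} (m : X ⟶ Y), IsRegularMono m → M m
  left_stable : L.IsStableUnderBaseChange
  right_stable : M.IsStableUnderBaseChange

/-- The poset of `M`-subobjects of `X`. -/
abbrev MSub {E : Type u} [Category.{v} E] (M : MorphismProperty E) (X : E) :=
  {A : Subobject X // M A.arrow}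

/-- The poset is (the underlying poset of) a Boolean algebra. -/
def IsBooleanPoset (A : Type u) [PartialOrder A] : Prop :=
  ∃ B : BooleanAlgebra A, ∀ a b : A, B.le a b ↔ a ≤ b

/-- The Boolean algebra structure on a Boolean poset. -/
@[reducible]
def IsBooleanPoset.booleanAlgebra {A : Type u} [i : PartialOrder A]
    (h : IsBooleanPoset A) : BooleanAlgebra A :=
  { i with
    sup := h.choose.sup
    le_sup_left := fun a b => (h.choose_spec _ _).1 (h.choose.le_sup_left a b)
    le_sup_right := fun a b => (h.choose_spec _ _).1 (h.choose.le_sup_right a b)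
    sup_le := fun a b c h1 h2 => (h.choose_spec _ _).1
      (h.choose.sup_le a b c ((h.choose_spec _ _).2 h1) ((h.choose_spec _ _).2 h2))
    inf := h.choose.inf
    inf_le_left := fun a b => (h.choose_spec _ _).1 (h.choose.inf_le_left a b)
    inf_le_right := fun a b => (h.choose_spec _ _).1 (h.choose.inf_le_right a b)
    le_inf := fun a b c h1 h2 => (h.choose_spec _ _).1
      (h.choose.le_inf a b c ((h.choose_spec _ _).2 h1) ((h.choose_spec _ _).2 h2))
    le_sup_inf := fun a b c => (h.choose_spec _ _).1 (h.choose.le_sup_inf a b c)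
    compl := h.choose.compl
    top := h.choose.top
    bot := h.choose.bot
    inf_compl_le_bot := fun a => (h.choose_spec _ _).1 (h.choose.inf_compl_le_bot a)
    top_le_sup_compl := fun a => (h.choose_spec _ _).1 (h.choose.top_le_sup_compl a)
    le_top := fun a => (h.choose_spec _ _).1 (h.choose.le_top a)
    bot_le := fun a => (h.choose_spec _ _).1 (h.choose.bot_le a) }

section MSub

variable {E : Type u} [Category.{v} E] [HasFiniteLimits E] (L M : MorphismProperty E)

/-- The pullback `f⁻¹ A` of an `M`-subobject. -/
def MSub.pull [IsProperStable L M] {X Y : E} (f : X ⟶ Y) (A : MSub M Y) : MSub M X :=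
  ⟨(Subobject.pullback f).obj A.1,
    (IsProperStable.right_stable L).of_isPullback (Subobject.isPullback f A.1) A.2⟩

/-- The image of a morphism: the `M`-part of its factorization. -/
def MSub.imageOf [IsProperStable L M] {A X : E} (f : A ⟶ X) : MSub M X :=
  haveI := IsProperStable.mono (L := L) _ (L.factorizationData M f).hp
  ⟨Subobject.mk (L.factorizationData M f).p,
    (M.arrow_mk_iso_iff (Arrow.isoMk (Subobject.underlyingIso _) (Iso.refl _))).2
      (L.factorizationData M f).hp⟩

/-- The direct image `∃_f A`: the image of the composite `A ↪ X ⟶ Y`. -/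
def MSub.ex [IsProperStable L M] {X Y : E} (f : X ⟶ Y) (A : MSub M X) : MSub M Y :=
  MSub.imageOf L M (A.1.arrow ≫ f)

theorem MSub.gc [IsProperStable L M] {X Y : E} (f : X ⟶ Y) :
    GaloisConnection (MSub.ex L M f) (MSub.pull L M f) := by
  intro A B
  have hp := (L.factorizationData M (A.1.arrow ≫ f)).hp
  have hi := (L.factorizationData M (A.1.arrow ≫ f)).hi
  have fac := (L.factorizationData M (A.1.arrow ≫ f)).fac
  have := IsProperStable.mono (L := L) _ hp
  constructor
  · intro h
    have h' : Subobject.mk (L.factorizationData M (A.1.arrow ≫ f)).p ≤ B.1 := h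
    have e := Subobject.ofMkLE_arrow h'
    have sq := Subobject.isPullback f B.1
    refine Subobject.le_of_comm (sq.lift
      ((L.factorizationData M (A.1.arrow ≫ f)).i ≫ Subobject.ofMkLE _ _ h') A.1.arrow ?_)
      (sq.lift_snd _ _ _)
    rw [Category.assoc, e, fac]
  · intro h
    have h' : A.1 ≤ (Subobject.pullback f).obj B.1 := h
    have sq := Subobject.isPullback f B.1
    obtain ⟨d, ⟨-, hd⟩, -⟩ := IsOrthogonalFactorizationSystem.existsUnique_lift (L := L) (M := M)
      (L.factorizationData M (A.1.arrow ≫ f)).i B.1.arrow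
      (Subobject.ofLE _ _ h' ≫ Subobject.pullbackπ f B.1)
      (L.factorizationData M (A.1.arrow ≫ f)).p hi B.2
      (by rw [fac, Category.assoc, sq.w, Subobject.ofLE_arrow_assoc])
    exact Subobject.mk_le_of_comm d hd

/-- The posets of `M`-subobjects are Boolean algebras. -/
class HasBooleanSub : Prop extends IsProperStable L M where
  boolean : ∀ X : E, IsBooleanPoset (MSub M X)

/-- The Boolean algebra of `M`-subobjects of `X`. -/
def MSub.alg [HasBooleanSub L M] (X : E) : BoolAlg :=
  letI := (HasBooleanSub.boolean (L := L) (M := M) X).booleanAlgebra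
  BoolAlg.of (MSub M X)

/-- f-Boolean categories. -/
class IsFBoolean : Prop extends HasBooleanSub L M where
  pull_hom : ∀ {X Y : E} (f : X ⟶ Y), ∃ g : MSub.alg L M Y ⟶ MSub.alg L M X,
    ∀ A : MSub M Y, g A = MSub.pull L M f A

/-- The doctrine of `M`-subobjects of an f-Boolean category. -/
def subDoctrine [IsFBoolean L M] : ExistentialDoctrine E where
  fib :=
    { obj := fun X => MSub.alg L M X.unop
      map := fun f => (IsFBoolean.pull_hom (L := L) (M := M) f.unop).choose
      map_id := fun X => by
        ext A
        refine ((IsFBoolean.pull_hom (L := L) (M := M) (𝟙 X : X ⟶ X).unop).choose_spec A).trans ?_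
        exact Subtype.ext (Subobject.pullback_id _)
      map_comp := fun {X Y Z} f g => by
        ext A
        refine ((IsFBoolean.pull_hom (L := L) (M := M) (f ≫ g).unop).choose_spec A).trans ?_
        refine Eq.trans ?_
          ((IsFBoolean.pull_hom (L := L) (M := M) g.unop).choose_spec _).symm
        refine Eq.trans ?_ (congrArg (MSub.pull L M g.unop)
          ((IsFBoolean.pull_hom (L := L) (M := M) f.unop).choose_spec A).symm)
        exact Subtype.ext (Subobject.pullback_comp _ _ _) }
  ex := fun f A => MSub.ex L M f A
  gc := fun f A B => by
    have h := (IsFBoolean.pull_hom (L := L) (M := M) f).choose_spec B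
    exact (MSub.gc L M f A B).trans (iff_of_eq (congrArg (fun T : MSub M _ => A ≤ T) h.symm))

/-- The partial maps `X ⇀ Y`, as relations: the graphs `(d, t) : A ⟶ X ⨯ Y`, where `d : A ↪ X` is an
embedding and `t : A ⟶ Y` a morphism. -/
def partialMaps [IsFBoolean L M] (X Y : E) : Set ((subDoctrine L M).Pred (X ⨯ Y)) :=
  {R : MSub M (X ⨯ Y) | ∃ (A : E) (d : A ⟶ X) (t : A ⟶ Y) (i : (R.1 : E) ≅ A),
    M d ∧ i.hom ≫ prod.lift d t = R.1.arrow}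

/-- `dia` makes the f-Boolean category a modal category. -/
structure IsModalCategory [IsFBoolean L M]
    (dia : ∀ X : E, (subDoctrine L M).Pred X → (subDoctrine L M).Pred X) : Prop where
  dia_bot : ∀ X : E, dia X ⊥ = ⊥
  dia_sup : ∀ (X : E) (A B : (subDoctrine L M).Pred X), dia X (A ⊔ B) = dia X A ⊔ dia X B
  lax : ∀ {X Y : E} (f : X ⟶ Y) (A : (subDoctrine L M).Pred Y),
    dia X ((subDoctrine L M).pull f A) ≤ (subDoctrine L M).pull f (dia Y A)
  embedding : ∀ {X Y : E} (m : X ⟶ Y), M m → ∀ A : (subDoctrine L M).Pred X,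
    dia X A = (subDoctrine L M).pull m (dia Y ((subDoctrine L M).ex m A))

/-- `dia` makes the f-Boolean category a topological modal category. -/
structure IsTopologicalModalCategory [IsFBoolean L M]
    (dia : ∀ X : E, (subDoctrine L M).Pred X → (subDoctrine L M).Pred X) : Prop extends
    IsModalCategory L M dia where
  le_dia : ∀ (X : E) (A : (subDoctrine L M).Pred X), A ≤ dia X A
  dia_dia : ∀ (X : E) (A : (subDoctrine L M).Pred X), dia X (dia X A) = dia X A
  product_independence : (subDoctrine L M).ProductIndependence dia
  loop_contraction : (subDoctrine L M).LoopContraction dia (partialMaps L M)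

end MSub

end

noncomputable section

/-! ### Internal logic: eliminating existentials in an arbitrary context -/

namespace BooleanDoctrine

variable {C : Type u} [Category.{v} C] [HasFiniteProducts C] (P : BooleanDoctrine.{w} C)

/-! Two layers of generalized elements carry the proof. In the base category, `a ≤ P.ev R x y` is
read as a sequent: under the hypothesis `a`, the terms `x` and `y` in the context `W` satisfy `R`;
existentials are eliminated by enlarging the context. In the syntactic category, a morphism `a : T ⟶
φ` is an element of a predicate `A` if its range lies below `A` (`Mem`). Predicates below `φ` are
determined by their elements (`le_iff_mem`), and surjections act as covers along which membership
descends (`mem_comp_iff`).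

Products come from products of the base, where the closure of distinguished partial maps under
composition and products makes pairings continuous; equalizers are the predicates `f(x) = g(x)`.
Embeddings turn out to be exactly the maps with the right lifting property against surjections
(`embeddings_eq`), so most of the factorization system is formal; stability of surjections is
witnessed by the relation `g(y) = f(x)`. An embedding amounts to its range, so subobjects of `φ` are
the predicates below it (`subIso`), and inverse images are computed in the doctrine.

For the modal axioms, the key is that the loop `R, R⁻¹` turns loop contraction into continuity of
every map contained in a distinguished partial map `R` (`dia_le_preim`). In particular isomorphisms
respect `◇`, which gives the embedding law and allows product independence to be moved from the
product of the base to the categorical product.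

Loop contraction is transferred by dominating each acceptable loop of subobjects by an acceptable
loop of the doctrine (`exists_acceptable`). The dominating loop may be longer: a categorical product
is only isomorphic to a product of the base, and the comparison costs a conjugation by a
distinguished partial map. An additional member does no harm, since it relates each element to its
own image and `A ≤ ◇A`. When a product of loops is formed, their lengths are made equal by inserting
identity relations, which acceptability permits. -/

theorem pull_sup {X Y : C} (f : X ⟶ Y) (A B : P.Pred Y) :
    P.pull f (A ⊔ B) = P.pull f A ⊔ P.pull f B :=
  map_sup (P.fib.map f.op).hom A B

theorem pull_bot {X Y : C} (f : X ⟶ Y) : P.pull f (⊥ : P.Pred Y) = ⊥ :=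
  map_bot (P.fib.map f.op).hom

theorem ev_pull_snd {W X Y : C} (B : P.Pred Y) (f : W ⟶ X) (g : W ⟶ Y) :
    P.ev (P.pull (prod.snd : X ⨯ Y ⟶ Y) B) f g = P.pull g B := by
  rw [ev, pull_pull, prod.lift_snd]

theorem ev_graph {W X Y : C} (f : X ⟶ Y) (x : W ⟶ X) (y : W ⟶ Y) :
    P.ev (P.graph f) x y = P.ev (P.idRel Y) (x ≫ f) y := by
  simp [ev, ExistentialDoctrine.graph, pull_pull]

theorem ev_relProd {W X Y X' Y' : C} (R : P.Pred (X ⨯ Y)) (S : P.Pred (X' ⨯ Y'))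
    (x : W ⟶ X ⨯ X') (y : W ⟶ Y ⨯ Y') :
    P.ev (P.relProd R S) x y =
      P.ev R (x ≫ prod.fst) (y ≫ prod.fst) ⊓ P.ev S (x ≫ prod.snd) (y ≫ prod.snd) := by
  simp [ev, ExistentialDoctrine.relProd, pull_pull, pull_inf]

theorem le_pull_trans {W V : C} {p : V ⟶ W} {a b : P.Pred W} {c : P.Pred V}
    (h : c ≤ P.pull p a) (k : a ≤ b) : c ≤ P.pull p b := h.trans (P.pull_mono p k)

theorem le_ev_of_le_pull {V W X Y : C} {p : V ⟶ W} {a : P.Pred W} {c : P.Pred V}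
    {R : P.Pred (X ⨯ Y)} {f : W ⟶ X} {g : W ⟶ Y} (h : c ≤ P.pull p a) (k : a ≤ P.ev R f g) :
    c ≤ P.ev R (p ≫ f) (p ≫ g) := by
  rw [← pull_ev]
  exact P.le_pull_trans h k

theorem le_pull_of_le_pull {V W X : C} {p : V ⟶ W} {a : P.Pred W} {c : P.Pred V}
    {A : P.Pred X} {f : W ⟶ X} (h : c ≤ P.pull p a) (k : a ≤ P.pull f A) :
    c ≤ P.pull (p ≫ f) A := by
  rw [← pull_pull]
  exact P.le_pull_trans h k

/-- The projection that introduces the witness is replaced by an arbitrary `p`, and the accumulated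
meet by an arbitrary hypothesis `c`, so that nested eliminations do not build up projections. -/
theorem relComp_cases {W X Y Z : C} {R : P.Pred (X ⨯ Y)} {S : P.Pred (Y ⨯ Z)} {a b : P.Pred W}
    {f : W ⟶ X} {g : W ⟶ Z} (h : a ≤ P.ev (P.relComp R S) f g)
    (k : ∀ {V : C} (p : V ⟶ W) (y : V ⟶ Y) (c : P.Pred V), c ≤ P.pull p a →
      c ≤ P.ev R (p ≫ f) y → c ≤ P.ev S y (p ≫ g) → c ≤ P.pull p b) : a ≤ b :=
  P.relComp_elim h (k _ _ _ inf_le_left (inf_le_right.trans inf_le_left)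
    (inf_le_right.trans inf_le_right))

theorem dom_cases {W X Y : C} {R : P.Pred (X ⨯ Y)} {a b : P.Pred W} {f : W ⟶ X}
    (h : a ≤ P.pull f (P.dom R))
    (k : ∀ {V : C} (p : V ⟶ W) (y : V ⟶ Y) (c : P.Pred V), c ≤ P.pull p a →
      c ≤ P.ev R (p ≫ f) y → c ≤ P.pull p b) : a ≤ b :=
  P.dom_elim h (k _ _ _ inf_le_left inf_le_right)

theorem im_cases {W X Y : C} {R : P.Pred (X ⨯ Y)} {a b : P.Pred W} {g : W ⟶ Y}
    (h : a ≤ P.pull g (P.im R))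
    (k : ∀ {V : C} (p : V ⟶ W) (x : V ⟶ X) (c : P.Pred V), c ≤ P.pull p a →
      c ≤ P.ev R x (p ≫ g) → c ≤ P.pull p b) : a ≤ b :=
  P.im_elim h (k _ _ _ inf_le_left inf_le_right)

/-- It is enough to test the generic element `𝟙 X` under the hypothesis `A`. -/
theorem le_of_pull {X : C} {A B : P.Pred X}
    (h : ∀ {W : C} (a : P.Pred W) (x : W ⟶ X), a ≤ P.pull x A → a ≤ P.pull x B) : A ≤ B := by
  simpa only [pull_id] using h A (𝟙 X) (P.pull_id A).ge

theorem im_le_of_ev {X Y : C} {R : P.Pred (X ⨯ Y)} {B : P.Pred Y}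
    (h : ∀ {W : C} (a : P.Pred W) (x : W ⟶ X) (y : W ⟶ Y), a ≤ P.ev R x y → a ≤ P.pull y B) :
    P.im R ≤ B :=
  P.im_le (h R prod.fst prod.snd (P.ev_fst_snd R).ge)

theorem image_intro {W X Y : C} {R : P.Pred (X ⨯ Y)} {A : P.Pred X} {a : P.Pred W} {x : W ⟶ X}
    {y : W ⟶ Y} (h : a ≤ P.ev R x y) (k : a ≤ P.pull x A) : a ≤ P.pull y (P.image R A) := by
  refine P.im_intro (R := R ⊓ P.pull prod.fst A) x ?_
  rw [ev_inf, ev_pull_fst]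
  exact le_inf h k

/-- One-point rule: the intermediate variable is forced to be `f(x)`. It serves to evaluate the
composite with the graph of a diagonal from which pairings are built. -/
theorem ev_relComp_graph {W X Y Z : C} (f : X ⟶ Y) (S : P.Pred (Y ⨯ Z)) (x : W ⟶ X) (z : W ⟶ Z) :
    P.ev (P.relComp (P.graph f) S) x z = P.ev S (x ≫ f) z := by
  apply le_antisymm
  · refine P.relComp_cases le_rfl fun p y c _ h1 h2 => ?_
    rw [ev_graph] at h1
    rw [pull_ev, ← Category.assoc]
    exact P.eq_subst S (P.eq_symm h1) h2
  · refine P.relComp_intro (x ≫ f) ?_ le_rfl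
    rw [ev_graph]
    exact P.eq_refl _ _

theorem functional_mono {X Y : C} {R S : P.Pred (X ⨯ Y)} (h : R ≤ S) (hS : P.IsFunctional S) :
    P.IsFunctional R :=
  P.functional_intro fun _ _ _ _ h1 h2 =>
    P.functional_elim hS (h1.trans (P.ev_mono h _ _)) (h2.trans (P.ev_mono h _ _))

end BooleanDoctrine

/-! ### Continuous maps as total single-valued relations -/

namespace TopologicalModalDoctrine

open BooleanDoctrine

variable {C : Type u} [Category.{v} C] [HasFiniteProducts C] {D : TopologicalModalDoctrine.{w} C}

/-- The relation underlying a continuous map. -/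
def rel {φ ψ : D.SyntS4} (f : φ ⟶ ψ) : D.Pred (φ.obj.base ⨯ ψ.obj.base) := Synt.Hom.rel f.hom

theorem ev_rel_incl {X W : C} {A B : D.Pred X} (h : A ≤ B) (x y : W ⟶ X) :
    D.ev (rel (SyntS4.incl D h)) x y = D.pull x A ⊓ D.ev (D.idRel X) x y :=
  D.ev_restrict _ _ _ _

section Forcing

variable {φ ψ θ : D.SyntS4} {W : C} {a b : D.Pred W}

theorem rel_left {f : φ ⟶ ψ} {x : W ⟶ φ.obj.base} {y : W ⟶ ψ.obj.base}
    (h : a ≤ D.ev (rel f) x y) : a ≤ D.pull x φ.obj.pred :=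
  D.le_pull_of_dom_le (Synt.Hom.dom_eq f.hom).le h

theorem rel_right {f : φ ⟶ ψ} {x : W ⟶ φ.obj.base} {y : W ⟶ ψ.obj.base}
    (h : a ≤ D.ev (rel f) x y) : a ≤ D.pull y ψ.obj.pred :=
  D.le_pull_of_im_le (Synt.Hom.im_le f.hom) h

theorem rel_unique {f : φ ⟶ ψ} {x : W ⟶ φ.obj.base} {y y' : W ⟶ ψ.obj.base}
    (h : a ≤ D.ev (rel f) x y) (h' : a ≤ D.ev (rel f) x y') : a ≤ D.ev (D.idRel _) y y' :=
  D.functional_elim (Synt.Hom.functional f.hom) h h'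

theorem rel_total (f : φ ⟶ ψ) {x : W ⟶ φ.obj.base} (h : a ≤ D.pull x φ.obj.pred)
    (k : ∀ {V : C} (p : V ⟶ W) (y : V ⟶ ψ.obj.base) (c : D.Pred V), c ≤ D.pull p a →
      c ≤ D.ev (rel f) (p ≫ x) y → c ≤ D.pull p b) : a ≤ b :=
  D.dom_cases (R := rel f) (h.trans (D.pull_mono x (Synt.Hom.dom_eq f.hom).ge)) k

theorem rel_comp_intro {f : φ ⟶ ψ} {g : ψ ⟶ θ} {x : W ⟶ φ.obj.base} {y : W ⟶ ψ.obj.base}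
    {z : W ⟶ θ.obj.base} (h : a ≤ D.ev (rel f) x y) (k : a ≤ D.ev (rel g) y z) :
    a ≤ D.ev (rel (f ≫ g)) x z :=
  D.relComp_intro y h k

theorem rel_comp_cases {f : φ ⟶ ψ} {g : ψ ⟶ θ} {x : W ⟶ φ.obj.base} {z : W ⟶ θ.obj.base}
    (h : a ≤ D.ev (rel (f ≫ g)) x z)
    (k : ∀ {V : C} (p : V ⟶ W) (y : V ⟶ ψ.obj.base) (c : D.Pred V), c ≤ D.pull p a →
      c ≤ D.ev (rel f) (p ≫ x) y → c ≤ D.ev (rel g) y (p ≫ z) → c ≤ D.pull p b) : a ≤ b :=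
  D.relComp_cases h k

end Forcing

/-- One inclusion suffices: `f` has a value wherever `g` is defined, and since `g` is single-valued
that value is the value of `g`. -/
theorem hom_ext_of_ev {φ ψ : D.SyntS4} {f g : φ ⟶ ψ}
    (h : ∀ {W : C} (a : D.Pred W) (x : W ⟶ φ.obj.base) (y : W ⟶ ψ.obj.base),
      a ≤ D.ev (rel f) x y → a ≤ D.ev (rel g) x y) : f = g := by
  refine WideSubcategory.hom_ext _ (Synt.Hom.ext (le_antisymm (D.ev_elim h) ?_))
  refine D.ev_elim fun a x y h1 => rel_total f (rel_left h1) fun p y' c h2 h3 => ?_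
  rw [D.pull_ev]
  exact D.eq_subst_right _ (rel_unique (h _ _ _ h3) (D.le_ev_of_le_pull h2 h1)) h3

/-- The restriction of a distinguished partial map, as a continuous map. -/
def homMk {φ ψ : D.SyntS4} (R : D.Pred (φ.obj.base ⨯ ψ.obj.base)) (hR : R ∈ D.cont _ _)
    (hd : φ.obj.pred ≤ D.dom R) (hi : D.restrict R φ.obj.pred ≤ D.pull prod.snd ψ.obj.pred) :
    φ ⟶ ψ :=
  ⟨{ rel := D.restrict R φ.obj.pred
     functional := D.functional_mono inf_le_right (D.cont_functional R hR)
     dom_eq := by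
      refine le_antisymm (D.dom_le inf_le_left) (D.le_of_pull fun a x h => ?_)
      refine D.dom_cases (R := R) (D.le_pull_trans h hd) fun p y c h1 h2 => ?_
      rw [D.pull_pull]
      refine D.dom_intro y ?_
      rw [ev_restrict]
      exact le_inf (D.le_pull_of_le_pull h1 h) h2
     im_le := D.im_le hi }, R, hR, hd, rfl⟩

theorem ev_rel_homMk {φ ψ : D.SyntS4} (R : D.Pred (φ.obj.base ⨯ ψ.obj.base)) (hR : R ∈ D.cont _ _)
    (hd : φ.obj.pred ≤ D.dom R) (hi : D.restrict R φ.obj.pred ≤ D.pull prod.snd ψ.obj.pred)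
    {W : C} (x : W ⟶ φ.obj.base) (y : W ⟶ ψ.obj.base) :
    D.ev (rel (homMk R hR hd hi)) x y = D.pull x φ.obj.pred ⊓ D.ev R x y :=
  D.ev_restrict _ _ _ _

/-- Every continuous map is contained in a distinguished partial map. -/
theorem exists_cont {φ ψ : D.SyntS4} (f : φ ⟶ ψ) : ∃ R ∈ D.cont φ.obj.base ψ.obj.base,
    rel f = D.restrict R φ.obj.pred :=
  let ⟨R, hR, _, h⟩ := f.property
  ⟨R, hR, h⟩

/-- The continuous map given by a morphism of the base category. -/
def mapGraph {φ ψ : D.SyntS4} (f : φ.obj.base ⟶ ψ.obj.base)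
    (h : φ.obj.pred ≤ D.pull f ψ.obj.pred) : φ ⟶ ψ :=
  homMk (D.graph f) (D.cont_graph f)
    (D.le_of_pull fun a x _ => D.dom_intro (x ≫ f) (by
      rw [ev_graph]
      exact D.eq_refl _ _))
    (D.le_of_ev (by
      rw [ev_restrict, ev_graph, ev_pull_snd]
      refine D.eq_subst_pred _ inf_le_right (inf_le_left.trans ?_)
      rw [← D.pull_pull]
      exact D.pull_mono _ h))

theorem ev_rel_mapGraph {φ ψ : D.SyntS4} (f : φ.obj.base ⟶ ψ.obj.base)
    (h : φ.obj.pred ≤ D.pull f ψ.obj.pred) {W : C} (x : W ⟶ φ.obj.base) (y : W ⟶ ψ.obj.base) :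
    D.ev (rel (mapGraph f h)) x y =
      D.pull x φ.obj.pred ⊓ D.ev (D.idRel _) (x ≫ f) y := by
  rw [mapGraph, ev_rel_homMk, ev_graph]

theorem mapGraph_comp {φ ψ θ : D.SyntS4} (f : φ.obj.base ⟶ ψ.obj.base)
    (hf : φ.obj.pred ≤ D.pull f ψ.obj.pred) (g : ψ.obj.base ⟶ θ.obj.base)
    (hg : ψ.obj.pred ≤ D.pull g θ.obj.pred) (h : φ.obj.pred ≤ D.pull (f ≫ g) θ.obj.pred) :
    mapGraph f hf ≫ mapGraph g hg = mapGraph (φ := φ) (ψ := θ) (f ≫ g) h := by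
  symm
  refine hom_ext_of_ev fun a x y h1 => ?_
  rw [ev_rel_mapGraph] at h1
  have hx := h1.trans inf_le_left
  refine rel_comp_intro (y := x ≫ f) ?_ ?_ <;> rw [ev_rel_mapGraph]
  · exact le_inf hx (D.eq_refl _ _)
  · refine le_inf (D.le_pull_of_le_pull hx hf) ?_
    rw [Category.assoc]
    exact h1.trans inf_le_right

/-! ### Membership of generalized elements -/

/-- The generalized element `a` of `φ` lies in the predicate `A`. -/
def Mem {T φ : D.SyntS4} (a : T ⟶ φ) (A : D.Pred φ.obj.base) : Prop := D.im (rel a) ≤ A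

section Mem

variable {T T' φ ψ θ : D.SyntS4}

theorem mem_iff {a : T ⟶ φ} {A : D.Pred φ.obj.base} :
    Mem a A ↔ ∀ {W : C} (c : D.Pred W) (x : W ⟶ T.obj.base) (y : W ⟶ φ.obj.base),
      c ≤ D.ev (rel a) x y → c ≤ D.pull y A :=
  ⟨fun h _ _ _ _ h1 => D.le_pull_of_im_le h h1, fun h => D.im_le_of_ev h⟩

theorem Mem.mono {a : T ⟶ φ} {A B : D.Pred φ.obj.base} (h : Mem a A) (k : A ≤ B) : Mem a B :=
  le_trans h k

theorem mem_pred (a : T ⟶ φ) : Mem a φ.obj.pred := Synt.Hom.im_le a.hom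

theorem mem_inf {a : T ⟶ φ} {A B : D.Pred φ.obj.base} : Mem a (A ⊓ B) ↔ Mem a A ∧ Mem a B :=
  le_inf_iff

theorem mem_top (a : T ⟶ φ) : Mem a (⊤ : D.Pred φ.obj.base) := le_top

theorem Mem.comp {a : T ⟶ φ} {A : D.Pred φ.obj.base} (h : Mem a A) (k : T' ⟶ T) :
    Mem (k ≫ a) A := by
  rw [mem_iff] at h ⊢
  intro W c x y hc
  refine rel_comp_cases hc fun p t d _ _ h3 => ?_
  rw [D.pull_pull]
  exact h _ _ _ h3

/-- A point of `T` has a preimage under `k` in a larger context, and the value of `a` at the point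
is then a value of `k ≫ a`. -/
theorem mem_comp_iff {k : T' ⟶ T} (hk : D.surjections k) {a : T ⟶ φ} {A : D.Pred φ.obj.base} :
    Mem (k ≫ a) A ↔ Mem a A := by
  refine ⟨fun h => ?_, fun h => h.comp k⟩
  rw [mem_iff] at h ⊢
  intro W c x y hc
  refine D.im_cases (R := rel k) (D.le_pull_trans (rel_left hc) (Eq.ge hk)) fun p t d h1 h2 => ?_
  rw [D.pull_pull]
  exact h _ _ _ (rel_comp_intro h2 (D.le_ev_of_le_pull h1 hc))

theorem mem_mapGraph {a : T ⟶ φ} {f : φ.obj.base ⟶ ψ.obj.base}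
    {hf : φ.obj.pred ≤ D.pull f ψ.obj.pred} {B : D.Pred ψ.obj.base} :
    Mem (a ≫ mapGraph f hf) B ↔ Mem a (D.pull f B) := by
  rw [mem_iff, mem_iff]
  constructor
  · intro h W c x y hc
    rw [D.pull_pull]
    refine h c x _ (rel_comp_intro hc ?_)
    rw [ev_rel_mapGraph]
    exact le_inf (rel_right hc) (D.eq_refl _ _)
  · intro h W c x y hc
    refine rel_comp_cases hc fun p t d _ h2 h3 => ?_
    rw [ev_rel_mapGraph] at h3
    have := h _ _ _ h2
    rw [D.pull_pull] at this ⊢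
    exact D.eq_subst_pred _ (h3.trans inf_le_right) this

theorem mem_incl {X : C} {A B A' : D.Pred X} (h : A ≤ B) (hA : A ≤ A') :
    Mem (φ := SyntS4.of D B) (SyntS4.incl D h) A' :=
  (D.im_restrict_id_le A).trans hA

theorem im_incl {X : C} {A B : D.Pred X} (h : A ≤ B) : D.im (rel (SyntS4.incl D h)) = A := by
  refine le_antisymm (mem_incl h le_rfl) (D.le_of_pull fun a x hx => D.im_intro x ?_)
  rw [ev_rel_incl]
  exact le_inf hx (D.eq_refl _ _)

/-- The inclusion of `A` into `φ` is the generic element of `A`; it exists by `hA`. -/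
theorem le_iff_mem {A B : D.Pred φ.obj.base} (hA : A ≤ φ.obj.pred) :
    A ≤ B ↔ ∀ {T : D.SyntS4} (a : T ⟶ φ), Mem a A → Mem a B := by
  refine ⟨fun h _ _ k => k.mono h, fun h => ?_⟩
  have := h (SyntS4.incl D hA) (mem_incl hA le_rfl)
  rw [Mem, im_incl] at this
  exact this

/-- The factorization of a generalized element of `A` through the inclusion of `A`. -/
def codRestrict (a : T ⟶ φ) (A : D.Pred φ.obj.base) (h : Mem a A) : T ⟶ SyntS4.of D A :=
  -- Continuity depends only on the source predicate and the two base objects, so it survives a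
  -- change of the target predicate.
  ⟨{ a.hom with im_le := h }, a.property⟩

theorem codRestrict_incl (a : T ⟶ φ) {A : D.Pred φ.obj.base} (h : Mem a A) (hA : A ≤ φ.obj.pred) :
    codRestrict a A h ≫ SyntS4.incl D hA = a :=
  WideSubcategory.hom_ext _ (Synt.Hom.ext (D.relComp_restrict_id h))

end Mem

/-- The inverse image of a predicate under a continuous map. -/
def preim {φ ψ : D.SyntS4} (f : φ ⟶ ψ) (B : D.Pred ψ.obj.base) : D.Pred φ.obj.base :=
  D.dom (rel f ⊓ D.pull prod.snd B)

section Preim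

variable {T φ ψ : D.SyntS4} (f : φ ⟶ ψ)

theorem preim_le (B : D.Pred ψ.obj.base) : preim f B ≤ φ.obj.pred :=
  (D.dom_mono inf_le_left).trans (Synt.Hom.dom_eq f.hom).le

variable {f}

/-- Since `f` is single-valued, having some value in `B` is the same as having the value `y` in `B`.
-/
theorem le_pull_preim {W : C} {a : D.Pred W} {x : W ⟶ φ.obj.base} {y : W ⟶ ψ.obj.base}
    {B : D.Pred ψ.obj.base} (h : a ≤ D.ev (rel f) x y) :
    a ≤ D.pull x (preim f B) ↔ a ≤ D.pull y B := by
  constructor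
  · intro k
    refine D.dom_cases k fun p y' c h1 h2 => ?_
    rw [ev_inf, ev_pull_snd] at h2
    rw [D.pull_pull]
    exact D.eq_subst_pred B (rel_unique (h2.trans inf_le_left) (D.le_ev_of_le_pull h1 h))
      (h2.trans inf_le_right)
  · intro k
    refine D.dom_intro y ?_
    rw [ev_inf, ev_pull_snd]
    exact le_inf h k

theorem mem_preim {a : T ⟶ φ} {B : D.Pred ψ.obj.base} : Mem a (preim f B) ↔ Mem (a ≫ f) B := by
  rw [mem_iff, mem_iff]
  constructor
  · intro h W c z y hc
    refine rel_comp_cases hc fun p x d _ h2 h3 => ?_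
    rw [D.pull_pull]
    exact (le_pull_preim h3).1 (h _ _ _ h2)
  · intro h W c z x hc
    refine rel_total f (rel_right hc) fun p y d h1 h2 => ?_
    rw [D.pull_pull]
    exact (le_pull_preim h2).2 (h _ _ _ (rel_comp_intro (D.le_ev_of_le_pull h1 hc) h2))

theorem preim_inf (A B : D.Pred ψ.obj.base) : preim f (A ⊓ B) = preim f A ⊓ preim f B := by
  apply le_antisymm
  · rw [le_iff_mem (preim_le f _)]
    intro T a h
    rwa [mem_inf, mem_preim, mem_preim, ← mem_inf, ← mem_preim]
  · rw [le_iff_mem (inf_le_left.trans (preim_le f _))]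
    intro T a h
    rwa [mem_inf, mem_preim, mem_preim, ← mem_inf, ← mem_preim] at h

/-- An element of a join need not lie in either part, so testing on elements does not help here; the
reason is that `dom` is a left adjoint and preserves joins. -/
theorem preim_sup (A B : D.Pred ψ.obj.base) : preim f (A ⊔ B) = preim f A ⊔ preim f B := by
  rw [preim, D.pull_sup, inf_sup_left]
  exact (D.gc prod.fst).l_sup

theorem preim_bot : preim f (⊥ : D.Pred ψ.obj.base) = ⊥ := by
  rw [preim, D.pull_bot, inf_bot_eq]
  exact (D.gc prod.fst).l_bot

theorem preim_pred : preim f ψ.obj.pred = φ.obj.pred := by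
  refine le_antisymm (preim_le f _) ((le_iff_mem le_rfl).2 fun a _ => ?_)
  rw [mem_preim]
  exact mem_pred _

end Preim

/-! ### Modalities -/

theorem dia_mono (X : C) {A B : D.Pred X} (h : A ≤ B) : D.dia X A ≤ D.dia X B := by
  rw [← sup_eq_right.2 h, D.dia_sup]
  exact le_sup_left

/-- Continuous maps satisfy the continuity condition. -/
theorem dia_le_preim {φ ψ : D.SyntS4} (f : φ ⟶ ψ) {A : D.Pred φ.obj.base} {B : D.Pred ψ.obj.base}
    (h : A ≤ preim f B) : φ.obj.pred ⊓ D.dia _ A ≤ preim f (D.dia _ B) := by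
  obtain ⟨R, hR, e⟩ := exists_cont f
  have ev_f : ∀ {W : C} {a : D.Pred W} {x : W ⟶ φ.obj.base} {y : W ⟶ ψ.obj.base},
      a ≤ D.ev (rel f) x y → a ≤ D.ev R x y := fun h1 =>
    h1.trans (D.ev_mono (e.le.trans inf_le_right) _ _)
  -- Each point of `A` has a value under `f` in `B`, and is related to it by `R`.
  have hA : A ≤ D.image (D.conv R) B := by
    refine h.trans (D.le_of_pull fun a x hx => ?_)
    refine rel_total f (D.le_pull_trans hx (preim_le f B)) fun p y c h1 h2 => ?_
    rw [D.pull_pull]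
    refine D.image_intro (x := y) ?_ ?_
    · rw [ev_conv]
      exact ev_f h2
    · exact (le_pull_preim h2).1 (D.le_pull_of_le_pull h1 hx)
  -- The loop `R, R⁻¹` is the conjugate of the empty loop on the source.
  have lc : D.dia _ (D.image R (D.dia _ (D.image (D.conv R) B))) ≤ D.dia _ B :=
    D.loop_contraction _ _ (.conj R _ hR (.nil _)) B
  refine D.le_of_pull fun a x hx => ?_
  refine rel_total f (D.le_pull_trans hx inf_le_left) fun p y c h1 h2 => ?_
  rw [D.pull_pull, le_pull_preim h2]
  have h3 : c ≤ D.pull y (D.image R (D.dia _ (D.image (D.conv R) B))) :=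
    D.image_intro (ev_f h2)
      (D.le_pull_trans (D.le_pull_of_le_pull h1 hx) (inf_le_right.trans (dia_mono _ hA)))
  exact D.le_pull_trans h3 ((D.le_dia _ _).trans lc)

/-- Continuity in terms of elements. The later transfers of `◇` along a map all take this form: only
the effect of `f` on the elements of `A` has to be known. -/
theorem Mem.dia_comp {T φ ψ : D.SyntS4} (f : φ ⟶ ψ) {A : D.Pred φ.obj.base}
    {B : D.Pred ψ.obj.base} (hA : A ≤ φ.obj.pred)
    (h : ∀ {T : D.SyntS4} (a : T ⟶ φ), Mem a A → Mem (a ≫ f) B) {b : T ⟶ φ}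
    (hb : Mem b (D.dia _ A)) : Mem (b ≫ f) (D.dia _ B) := by
  rw [← mem_preim]
  refine Mem.mono (mem_inf.2 ⟨mem_pred b, hb⟩) (dia_le_preim f ((le_iff_mem hA).2 fun a ha => ?_))
  exact mem_preim.2 (h a ha)

/-! ### Finite limits -/

/-- The terminal object. -/
abbrev unit (D : TopologicalModalDoctrine.{w} C) : D.SyntS4 := SyntS4.of D (⊤ : D.Pred (⊤_ C))

/-- The map to the terminal object. -/
def toUnit (φ : D.SyntS4) : φ ⟶ unit D :=
  mapGraph (terminal.from _) (le_top.trans (D.pull_top _).ge)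

theorem toUnit_unique {φ : D.SyntS4} (f : φ ⟶ unit D) : f = toUnit φ := by
  refine hom_ext_of_ev fun a x y h => ?_
  rw [toUnit, ev_rel_mapGraph]
  refine le_inf (rel_left h) ?_
  rw [Subsingleton.elim (x ≫ terminal.from _) y]
  exact D.eq_refl _ _

instance : HasTerminal D.SyntS4 :=
  IsTerminal.hasTerminal (X := unit D)
    (IsTerminal.ofUniqueHom (fun φ => toUnit φ) fun _ f => toUnit_unique f)

/-- The product of two objects. -/
abbrev tensor (φ ψ : D.SyntS4) : D.SyntS4 :=
  SyntS4.of D (D.pull (prod.fst : φ.obj.base ⨯ ψ.obj.base ⟶ _) φ.obj.pred ⊓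
    D.pull prod.snd ψ.obj.pred)

def proj₁ (φ ψ : D.SyntS4) : tensor φ ψ ⟶ φ := mapGraph prod.fst inf_le_left

def proj₂ (φ ψ : D.SyntS4) : tensor φ ψ ⟶ ψ := mapGraph prod.snd inf_le_right

/-! ### Pairings and binary products -/

section Pair

variable {T φ ψ : D.SyntS4}

/-- The relation `R(x,y) ∧ S(x,z)` is distinguished, being the composite of the graph of the
diagonal with `R × S`. Restricted to `T`, it depends only on `a` and `b`. -/
theorem exists_pair (a : T ⟶ φ) (b : T ⟶ ψ) : ∃ p : T ⟶ tensor φ ψ,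
    ∀ {W : C} (x : W ⟶ T.obj.base) (y : W ⟶ φ.obj.base ⨯ ψ.obj.base),
      D.ev (rel p) x y = D.ev (rel a) x (y ≫ prod.fst) ⊓ D.ev (rel b) x (y ≫ prod.snd) := by
  obtain ⟨R, hR, ha⟩ := exists_cont a
  obtain ⟨S, hS, hb⟩ := exists_cont b
  have key : ∀ {W : C} (x : W ⟶ T.obj.base) (y : W ⟶ φ.obj.base ⨯ ψ.obj.base),
      D.pull x T.obj.pred ⊓ D.ev (D.relComp (D.graph (diag _)) (D.relProd R S)) x y =
        D.ev (rel a) x (y ≫ prod.fst) ⊓ D.ev (rel b) x (y ≫ prod.snd) := by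
    intro W x y
    rw [ha, hb, ev_restrict, ev_restrict, ev_relComp_graph, ev_relProd, Category.assoc,
      Category.assoc, prod.lift_fst, prod.lift_snd, Category.comp_id, inf_inf_distrib_left]
  refine ⟨homMk (D.relComp (D.graph (diag _)) (D.relProd R S))
    (D.cont_comp _ (D.cont_graph _) _ (D.cont_prod _ hR _ hS)) ?_ ?_, fun x y => ?_⟩
  · refine D.le_of_pull fun c x hc => ?_
    refine rel_total a hc fun p y d h1 h2 => ?_
    refine rel_total b (D.le_pull_of_le_pull h1 hc) fun q z e h3 h4 => ?_
    rw [D.pull_pull, D.pull_pull]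
    refine D.dom_intro (prod.lift (q ≫ y) z) (le_trans ?_ ((key _ _).ge.trans inf_le_right))
    rw [prod.lift_fst, prod.lift_snd, Category.assoc]
    exact le_inf (D.le_ev_of_le_pull h3 h2) h4
  · refine D.le_of_ev ?_
    rw [ev_restrict, key, ev_pull_snd, D.pull_inf, D.pull_pull, D.pull_pull]
    exact le_inf (rel_right inf_le_left) (rel_right inf_le_right)
  · rw [ev_rel_homMk, key]

/-- The pairing of two continuous maps. -/
def pair (a : T ⟶ φ) (b : T ⟶ ψ) : T ⟶ tensor φ ψ := (exists_pair a b).choose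

theorem ev_rel_pair (a : T ⟶ φ) (b : T ⟶ ψ) {W : C} (x : W ⟶ T.obj.base)
    (y : W ⟶ φ.obj.base ⨯ ψ.obj.base) : D.ev (rel (pair a b)) x y =
      D.ev (rel a) x (y ≫ prod.fst) ⊓ D.ev (rel b) x (y ≫ prod.snd) :=
  (exists_pair a b).choose_spec x y

theorem ev_rel_comp_mapGraph (a : T ⟶ φ) (f : φ.obj.base ⟶ ψ.obj.base)
    (hf : φ.obj.pred ≤ D.pull f ψ.obj.pred) {W : C} {c : D.Pred W} {x : W ⟶ T.obj.base}
    {y : W ⟶ φ.obj.base} (h : c ≤ D.ev (rel a) x y) :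
    c ≤ D.ev (rel (a ≫ mapGraph f hf)) x (y ≫ f) := by
  refine rel_comp_intro h ?_
  rw [ev_rel_mapGraph]
  exact le_inf (rel_right h) (D.eq_refl _ _)

theorem pair_proj₁ (a : T ⟶ φ) (b : T ⟶ ψ) : pair a b ≫ proj₁ φ ψ = a := by
  symm
  refine hom_ext_of_ev fun c x y h => ?_
  -- A value of the pairing needs a second component, so a value of `b` is introduced first.
  refine rel_total b (rel_left h) fun p z d h1 h2 => ?_
  rw [D.pull_ev]
  have := ev_rel_comp_mapGraph (pair a b) (ψ := φ) prod.fst inf_le_left (c := d) (x := p ≫ x)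
    (y := prod.lift (p ≫ y) z) (by
      rw [ev_rel_pair, prod.lift_fst, prod.lift_snd]
      exact le_inf (D.le_ev_of_le_pull h1 h) h2)
  rwa [prod.lift_fst] at this

theorem pair_proj₂ (a : T ⟶ φ) (b : T ⟶ ψ) : pair a b ≫ proj₂ φ ψ = b := by
  symm
  refine hom_ext_of_ev fun c x y h => ?_
  refine rel_total a (rel_left h) fun p z d h1 h2 => ?_
  rw [D.pull_ev]
  have := ev_rel_comp_mapGraph (pair a b) (ψ := ψ) prod.snd inf_le_right (c := d) (x := p ≫ x)
    (y := prod.lift z (p ≫ y)) (by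
      rw [ev_rel_pair, prod.lift_fst, prod.lift_snd]
      exact le_inf h2 (D.le_ev_of_le_pull h1 h))
  rwa [prod.lift_snd] at this

theorem eq_pair (m : T ⟶ tensor φ ψ) : m = pair (m ≫ proj₁ φ ψ) (m ≫ proj₂ φ ψ) := by
  refine hom_ext_of_ev fun c x y h => ?_
  rw [ev_rel_pair]
  exact le_inf (ev_rel_comp_mapGraph m (ψ := φ) _ inf_le_left h)
    (ev_rel_comp_mapGraph m (ψ := ψ) _ inf_le_right h)

theorem tensor_hom_ext {m n : T ⟶ tensor φ ψ} (h₁ : m ≫ proj₁ φ ψ = n ≫ proj₁ φ ψ)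
    (h₂ : m ≫ proj₂ φ ψ = n ≫ proj₂ φ ψ) : m = n := by
  rw [eq_pair m, eq_pair n, h₁, h₂]

/-- The product of two objects is a categorical product. -/
def tensorIsLimit (φ ψ : D.SyntS4) : IsLimit (BinaryFan.mk (proj₁ φ ψ) (proj₂ φ ψ)) :=
  BinaryFan.isLimitMk (fun s => pair s.fst s.snd) (fun _ => pair_proj₁ _ _)
    (fun _ => pair_proj₂ _ _) fun _ _ h₁ h₂ => tensor_hom_ext
      (h₁.trans (pair_proj₁ _ _).symm) (h₂.trans (pair_proj₂ _ _).symm)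

end Pair

instance : HasBinaryProducts D.SyntS4 :=
  haveI : ∀ {φ ψ : D.SyntS4}, HasLimit (Limits.pair φ ψ) := ⟨_, tensorIsLimit _ _⟩
  hasBinaryProducts_of_hasLimit_pair _

/-! ### Equalizers -/

section Equalizer

variable {T φ ψ : D.SyntS4} (f g : φ ⟶ ψ)

/-- The predicate `f(x) = g(x)`. -/
def eqPred : D.Pred φ.obj.base := D.dom (rel f ⊓ rel g)

theorem eqPred_le : eqPred f g ≤ φ.obj.pred :=
  (D.dom_mono inf_le_left).trans (Synt.Hom.dom_eq f.hom).le

variable {f g}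

theorem mem_eqPred {a : T ⟶ φ} : Mem a (eqPred f g) ↔ a ≫ f = a ≫ g := by
  rw [mem_iff]
  constructor
  · refine fun h => hom_ext_of_ev fun c z y hc => rel_comp_cases hc fun p x d _ h2 h3 => ?_
    refine D.dom_cases (h _ _ _ h2) fun q y' e h4 h5 => ?_
    rw [D.pull_ev, D.pull_ev]
    rw [ev_inf] at h5
    have h6 := rel_unique (h5.trans inf_le_left) (D.le_ev_of_le_pull h4 h3)
    have h7 := D.eq_subst_right (rel g) h6 (h5.trans inf_le_right)
    have h8 := rel_comp_intro (D.le_ev_of_le_pull h4 h2) h7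
    exact h8
  · intro h W c z x hc
    refine rel_total f (rel_right hc) fun p y d h1 h2 => ?_
    have h3 := D.le_ev_of_le_pull h1 hc
    rw [D.pull_pull]
    refine D.dom_intro y ?_
    rw [ev_inf]
    have h7 : d ≤ D.ev (rel (a ≫ g)) (p ≫ z) y := by
      rw [← h]
      exact rel_comp_intro h3 h2
    refine le_inf h2 (rel_comp_cases h7 fun q x' e h4 h5 h6 => ?_)
    rw [D.pull_ev]
    exact D.eq_subst (rel g) (rel_unique h5 (D.le_ev_of_le_pull h4 h3)) h6

end Equalizer

instance : HasEqualizers D.SyntS4 :=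
  haveI : ∀ {φ ψ : D.SyntS4} {f g : φ ⟶ ψ}, HasLimit (parallelPair f g) := fun {_ _ f g} =>
    ⟨Fork.ofι (SyntS4.incl D (eqPred_le f g)) (mem_eqPred.1 (mem_incl _ le_rfl)),
      Fork.IsLimit.mk' _ fun s => ⟨codRestrict s.ι _ (mem_eqPred.2 s.condition),
        codRestrict_incl _ _ _, fun h => (cancel_mono (SyntS4.incl D (eqPred_le f g))).1
          (h.trans (codRestrict_incl _ _ _).symm)⟩⟩
  hasEqualizers_of_hasLimit_parallelPair _

instance : HasFiniteLimits D.SyntS4 :=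
  haveI : HasFiniteProducts D.SyntS4 := hasFiniteProducts_of_has_binary_and_terminal
  hasFiniteLimits_of_hasEqualizers_and_finite_products

/-! ### The factorization system -/

section Factorization

variable {T φ ψ θ : D.SyntS4}

theorem surjections_iff {f : φ ⟶ ψ} : D.surjections f ↔ ψ.obj.pred ≤ D.im (rel f) :=
  ⟨fun h => Eq.ge h, fun h => le_antisymm (mem_pred f) h⟩

/-- In this form, composition, right cancellation and the epimorphism property of surjections become
formal. -/
theorem surjections_iff_mem {f : φ ⟶ ψ} :
    D.surjections f ↔ ∀ A : D.Pred ψ.obj.base, Mem f A → Mem (𝟙 ψ) A := by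
  have h : D.im (rel (𝟙 ψ)) = ψ.obj.pred := im_incl le_rfl
  rw [surjections_iff, ← h]
  exact ⟨fun h A hA => le_trans h hA, fun h => h _ le_rfl⟩

/-- The predicate expressing equality of `g` and `g'` holds of `f`, hence of the identity. -/
theorem epi_of_surjections {f : φ ⟶ ψ} (h : D.surjections f) : Epi f where
  left_cancellation g g' e := by
    have := surjections_iff_mem.1 h _ (mem_eqPred.2 e)
    rwa [mem_eqPred, Category.id_comp, Category.id_comp] at this

instance : D.surjections.IsMultiplicative where
  id_mem _ := surjections_iff_mem.2 fun _ h => h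
  comp_mem _ _ hf hg := surjections_iff_mem.2 fun A h =>
    surjections_iff_mem.1 hg A ((mem_comp_iff hf).1 h)

theorem surjections_of_isIso (f : φ ⟶ ψ) [IsIso f] : D.surjections f :=
  surjections_iff_mem.2 fun A h => by
    rw [← IsIso.inv_hom_id f]
    exact h.comp _

instance : D.surjections.RespectsIso :=
  MorphismProperty.respectsIso_of_isStableUnderComposition fun _ _ f (_ : IsIso f) =>
    surjections_of_isIso f

theorem surjections_of_comp (f : φ ⟶ ψ) (g : ψ ⟶ θ) (h : D.surjections (f ≫ g)) :
    D.surjections g :=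
  surjections_iff_mem.2 fun A hA => surjections_iff_mem.1 h A (hA.comp f)

/-- The inclusion of a predicate on `φ`, as a morphism to `φ`. -/
def subIncl {A : D.Pred φ.obj.base} (h : A ≤ φ.obj.pred) : SyntS4.of D A ⟶ φ := SyntS4.incl D h

instance {A : D.Pred φ.obj.base} (h : A ≤ φ.obj.pred) : Mono (subIncl h) :=
  inferInstanceAs (Mono (SyntS4.incl D h))

theorem im_rel_le (f : φ ⟶ ψ) : D.im (rel f) ≤ ψ.obj.pred := mem_pred f

/-- The surjection of a map onto its range. -/
def toIm (f : φ ⟶ ψ) : φ ⟶ SyntS4.of D (D.im (rel f)) := codRestrict f _ le_rfl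

theorem toIm_incl (f : φ ⟶ ψ) : toIm f ≫ subIncl (im_rel_le f) = f := codRestrict_incl _ _ _

theorem surjections_toIm (f : φ ⟶ ψ) : D.surjections (toIm f) := rfl

/-- The lift is `g` with a smaller target: its values lie in `A` because they do so on the cover
`l`. -/
theorem hasLift_incl {X : C} {A B : D.Pred X} (h : A ≤ B) {l : φ ⟶ ψ} (hl : D.surjections l) :
    HasLiftingProperty l (SyntS4.incl D h) where
  sq_hasLift {f g} sq := by
    have hg : Mem (φ := SyntS4.of D B) g A := by
      rw [← mem_comp_iff hl, ← sq.w]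
      exact (mem_incl h le_rfl).comp f
    refine .mk' ⟨codRestrict g A hg, ?_, codRestrict_incl _ _ _⟩
    rw [← cancel_mono (SyntS4.incl D h), Category.assoc, codRestrict_incl, sq.w]

/-- Lifting `toIm f` against `f` gives a one-sided inverse; the other equation can be checked after
the inclusion of the range, which is monic. -/
theorem isIso_toIm {f : φ ⟶ ψ} (hf : D.surjections.rlp f) : IsIso (toIm f) := by
  have := hf _ (surjections_toIm f)
  have sq : CommSq (𝟙 φ) (toIm f) f (subIncl (im_rel_le f)) := ⟨by simp [toIm_incl]⟩
  refine ⟨sq.lift, sq.fac_left, ?_⟩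
  rw [← cancel_mono (subIncl (im_rel_le f)), Category.assoc, toIm_incl, sq.fac_right,
    Category.id_comp]

variable (D) in
-- Inclusions lift against surjections, and a map that lifts against its own surjection onto its
-- range is isomorphic to the inclusion of that range. Closure under composition, isomorphism and
-- pullback is then automatic for embeddings.
theorem embeddings_eq : D.embeddings = D.surjections.rlp := by
  apply le_antisymm
  · have : D.surjections.rlp.RespectsIso := inferInstance
    rw [embeddings, MorphismProperty.isoClosure_le_iff]
    rintro _ _ _ ⟨h⟩ _ _ l hl
    exact hasLift_incl h hl
  · intro φ ψ f hf
    have := isIso_toIm hf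
    exact ⟨_, _, _, ⟨im_rel_le f⟩,
      ⟨(Arrow.isoMk (f := Arrow.mk f) (g := Arrow.mk (subIncl (im_rel_le f)))
        (asIso (toIm f)) (Iso.refl _) ((toIm_incl f).trans (Category.comp_id f).symm)).symm⟩⟩

theorem embeddings_incl {X : C} {A B : D.Pred X} (h : A ≤ B) : D.embeddings (SyntS4.incl D h) :=
  MorphismProperty.le_isoClosure _ _ ⟨h⟩

theorem mono_of_embeddings {f : φ ⟶ ψ} (hf : D.embeddings f) : Mono f := by
  have : D.embeddings ≤ MorphismProperty.monomorphisms _ := by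
    rw [embeddings, MorphismProperty.isoClosure_le_iff]
    rintro _ _ _ ⟨h⟩
    exact inferInstanceAs (Mono (SyntS4.incl D h))
  exact this _ hf

/-- The given pullback is never computed. The object `A` of pairs with `g(y) = f(x)` projects onto
`X`, and this projection factors through the pullback; the last factor of a surjection is a
surjection. -/
instance : D.surjections.IsStableUnderBaseChange where
  of_isPullback {X Y Y' S f g f' g'} sq hg := by
    let A : D.Pred (Y.obj.base ⨯ X.obj.base) := D.relComp (rel g) (D.conv (rel f))
    have key : ∀ {W : C} {c : D.Pred W} {y : W ⟶ Y.obj.base} {x : W ⟶ X.obj.base}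
        {s : W ⟶ S.obj.base}, c ≤ D.ev (rel g) y s → c ≤ D.ev (rel f) x s → c ≤ D.ev A y x :=
      fun h1 h2 => D.relComp_intro _ h1 (by rwa [ev_conv])
    have key' : ∀ {W : C} {c b : D.Pred W} {y : W ⟶ Y.obj.base} {x : W ⟶ X.obj.base},
        c ≤ D.ev A y x → (∀ {V : C} (p : V ⟶ W) (s : V ⟶ S.obj.base) (d : D.Pred V),
          d ≤ D.pull p c → d ≤ D.ev (rel g) (p ≫ y) s → d ≤ D.ev (rel f) (p ≫ x) s →
            d ≤ D.pull p b) → c ≤ b :=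
      fun h k => D.relComp_cases h fun p s d h1 h2 h3 => k p s d h1 h2 (by rwa [ev_conv] at h3)
    have h₁ : A ≤ D.pull prod.fst Y.obj.pred :=
      key' (D.ev_fst_snd A).ge fun p s d _ h _ => by
        rw [D.pull_pull]
        exact rel_left h
    have h₂ : A ≤ D.pull prod.snd X.obj.pred :=
      key' (D.ev_fst_snd A).ge fun p s d _ _ h => by
        rw [D.pull_pull]
        exact rel_left h
    let p₁ : SyntS4.of D A ⟶ Y := mapGraph prod.fst h₁
    let p₂ : SyntS4.of D A ⟶ X := mapGraph prod.snd h₂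
    have ev_p₁ : ∀ {W : C} (z : W ⟶ Y.obj.base ⨯ X.obj.base) (y : W ⟶ Y.obj.base),
      D.ev (rel p₁) z y = D.pull z A ⊓ D.ev (D.idRel _) (z ≫ prod.fst) y := fun z y =>
        ev_rel_mapGraph (φ := SyntS4.of D A) _ h₁ z y
    have ev_p₂ : ∀ {W : C} (z : W ⟶ Y.obj.base ⨯ X.obj.base) (x : W ⟶ X.obj.base),
      D.ev (rel p₂) z x = D.pull z A ⊓ D.ev (D.idRel _) (z ≫ prod.snd) x := fun z x =>
        ev_rel_mapGraph (φ := SyntS4.of D A) _ h₂ z x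
    have w : p₁ ≫ g = p₂ ≫ f := by
      refine hom_ext_of_ev fun c z s h => rel_comp_cases h fun p y d _ h2 h3 => ?_
      rw [D.pull_ev]
      rw [ev_p₁] at h2
      have hA : d ≤ D.ev A ((p ≫ z) ≫ prod.fst) ((p ≫ z) ≫ prod.snd) := by
        rw [ev, ← prod.comp_lift, prod.lift_fst_snd, Category.comp_id]
        exact h2.trans inf_le_left
      refine key' hA fun q t e h4 h5 h6 => ?_
      rw [D.pull_ev]
      refine rel_comp_intro (y := q ≫ (p ≫ z) ≫ prod.snd) ?_ ?_
      · rw [ev_p₂, Category.assoc]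
        exact le_inf (D.le_pull_of_le_pull h4 (h2.trans inf_le_left)) (D.eq_refl _ _)
      -- The common value `t` supplied by `A` equals `s`, both being values of `g` at the first
      -- component.
      · have h7 := D.eq_subst (rel g) (D.eq_symm (D.le_ev_of_le_pull h4 (h2.trans inf_le_right)))
          (D.le_ev_of_le_pull h4 h3)
        exact D.eq_subst_right (rel f) (rel_unique h5 h7) h6
    have hp₂ : D.surjections p₂ := by
      refine surjections_iff.2 (D.le_of_pull fun a x hx => rel_total f hx fun p s c h1 h2 => ?_)
      refine D.im_cases (D.le_pull_trans (rel_right h2) (Eq.ge hg)) fun q y d h3 h4 => ?_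
      rw [D.pull_pull, D.pull_pull]
      refine D.im_intro (prod.lift y (q ≫ p ≫ x)) ?_
      rw [ev_p₂, prod.lift_snd, Category.assoc]
      exact le_inf (key h4 (D.le_ev_of_le_pull h3 h2)) (D.eq_refl _ _)
    refine surjections_of_comp (sq.lift p₁ p₂ w) g' ?_
    rwa [sq.lift_snd]

instance : IsProperStable D.surjections D.embeddings where
  left_isMultiplicative := inferInstance
  left_respectsIso := inferInstance
  right_isMultiplicative := by rw [embeddings_eq]; infer_instance
  right_respectsIso := by rw [embeddings_eq]; infer_instance
  hasFactorization := ⟨fun f => ⟨{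
    Z := _
    i := toIm f
    p := subIncl (im_rel_le f)
    fac := toIm_incl f
    hi := surjections_toIm f
    hp := embeddings_incl _ }⟩⟩
  existsUnique_lift l m f g hl hm e := by
    have := mono_of_embeddings hm
    rw [embeddings_eq] at hm
    have := hm l hl
    have sq : CommSq f l m g := ⟨e⟩
    exact ⟨sq.lift, ⟨sq.fac_left, sq.fac_right⟩, fun d hd =>
      (cancel_mono m).1 (hd.2.trans sq.fac_right.symm)⟩
  mono m hm := mono_of_embeddings hm
  -- Regular monomorphisms lift against all epimorphisms, in particular against surjections.
  regularMono m hm := by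
    rw [embeddings_eq]
    intro _ _ l hl
    have := epi_of_surjections hl
    infer_instance
  left_stable := inferInstance
  right_stable := by rw [embeddings_eq]; infer_instance

end Factorization

end TopologicalModalDoctrine

/-- The elements below `b` form a Boolean algebra. -/
@[reducible]
def Set.Iic.booleanAlgebra {B : Type w} [BooleanAlgebra B] (b : B) : BooleanAlgebra (Set.Iic b) :=
  { (inferInstance : Lattice (Set.Iic b)), (inferInstance : BoundedOrder (Set.Iic b)) with
    le_sup_inf := fun x y z => (sup_inf_left x.1 y.1 z.1).ge
    compl := fun x => ⟨b ⊓ x.1ᶜ, inf_le_left⟩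
    inf_compl_le_bot := fun x => by
      change x.1 ⊓ (b ⊓ x.1ᶜ) ≤ ⊥
      rw [inf_left_comm, inf_compl_self, inf_bot_eq]
    top_le_sup_compl := fun x => by
      change b ≤ x.1 ⊔ (b ⊓ x.1ᶜ)
      rw [sup_inf_left, sup_compl_eq_top, inf_top_eq]
      exact le_sup_right }

theorem IsBooleanPoset.of_orderIso {A : Type u} [PartialOrder A] {B : Type w} [BooleanAlgebra B]
    (e : A ≃o B) : IsBooleanPoset A :=
  ⟨{ (inferInstance : PartialOrder A) with
    sup := fun x y => e.symm (e x ⊔ e y)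
    le_sup_left := fun x y => by simp [OrderIso.le_symm_apply]
    le_sup_right := fun x y => by simp [OrderIso.le_symm_apply]
    sup_le := fun x y z h h' => by
      rw [OrderIso.symm_apply_le]
      exact sup_le (e.monotone h) (e.monotone h')
    inf := fun x y => e.symm (e x ⊓ e y)
    inf_le_left := fun x y => by simp [OrderIso.symm_apply_le]
    inf_le_right := fun x y => by simp [OrderIso.symm_apply_le]
    le_inf := fun x y z h h' => by
      rw [OrderIso.le_symm_apply]
      exact le_inf (e.monotone h) (e.monotone h')
    le_sup_inf := fun x y z => by
      change e.symm (e (e.symm (e x ⊔ e y)) ⊓ e (e.symm (e x ⊔ e z))) ≤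
        e.symm (e x ⊔ e (e.symm (e y ⊓ e z)))
      simp only [OrderIso.apply_symm_apply]
      exact e.symm.monotone le_sup_inf
    compl := fun x => e.symm (e x)ᶜ
    top := e.symm ⊤
    bot := e.symm ⊥
    inf_compl_le_bot := fun x => by
      change e.symm (e x ⊓ e (e.symm (e x)ᶜ)) ≤ e.symm ⊥
      rw [OrderIso.apply_symm_apply, inf_compl_self]
    top_le_sup_compl := fun x => by
      change e.symm ⊤ ≤ e.symm (e x ⊔ e (e.symm (e x)ᶜ))
      rw [OrderIso.apply_symm_apply, sup_compl_eq_top]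
    le_top := fun x => by
      change x ≤ e.symm ⊤
      simp [OrderIso.le_symm_apply]
    bot_le := fun x => by
      change e.symm ⊥ ≤ x
      simp [OrderIso.symm_apply_le] }, fun _ _ => Iff.rfl⟩

namespace TopologicalModalDoctrine

open BooleanDoctrine

variable {C : Type u} [Category.{v} C] [HasFiniteProducts C] {D : TopologicalModalDoctrine.{w} C}

/-! ### Subobjects -/

section Subobjects

variable {T φ ψ : D.SyntS4}

/-- The predicate corresponding to a subobject. -/
def pr (S : MSub D.embeddings φ) : D.Pred φ.obj.base := D.im (rel S.1.arrow)

theorem pr_le (S : MSub D.embeddings φ) : pr S ≤ φ.obj.pred := im_rel_le _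

theorem factors_iff_exists {S : Subobject φ} {a : T ⟶ φ} :
    S.Factors a ↔ ∃ b : T ⟶ (S : D.SyntS4), b ≫ S.arrow = a :=
  ⟨fun h => ⟨_, S.factorThru_arrow a h⟩, by
    rintro ⟨b, rfl⟩
    exact Subobject.factors_comp_arrow b⟩

/-- An embedding is isomorphic to the inclusion of its range, and factoring through an inclusion is
a condition on ranges only. -/
theorem factors_iff_mem {S : MSub D.embeddings φ} {a : T ⟶ φ} : S.1.Factors a ↔ Mem a (pr S) := by
  rw [factors_iff_exists]
  constructor
  · rintro ⟨b, rfl⟩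
    exact Mem.comp (a := S.1.arrow) le_rfl b
  · intro h
    have hS : D.surjections.rlp S.1.arrow := by
      rw [← embeddings_eq]
      exact S.2
    obtain ⟨j, -, hj⟩ := isIso_toIm hS
    have e : j ≫ S.1.arrow = subIncl (im_rel_le _) := by
      refine (congrArg (j ≫ ·) (toIm_incl S.1.arrow).symm).trans ?_
      rw [← Category.assoc, hj, Category.id_comp]
    refine ⟨codRestrict a _ h ≫ j, ?_⟩
    exact (Category.assoc _ _ _).trans ((congrArg (codRestrict a _ h ≫ ·) e).trans
      (codRestrict_incl _ _ _))

theorem msub_le_iff {S S' : MSub D.embeddings φ} : S ≤ S' ↔ pr S ≤ pr S' := by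
  refine Iff.trans ⟨fun h => ?_, Subobject.le_of_factors⟩ (factors_iff_mem (a := S.1.arrow))
  exact Subobject.factors_of_le _ h S.1.factors_self

/-- The subobject given by a predicate. -/
def mkSub (A : D.Pred φ.obj.base) (h : A ≤ φ.obj.pred) : MSub D.embeddings φ :=
  ⟨Subobject.mk (subIncl h),
    (D.embeddings.arrow_mk_iso_iff
      (Arrow.isoMk (f := Arrow.mk (Subobject.mk (subIncl h)).arrow)
        (g := Arrow.mk (subIncl h)) (Subobject.underlyingIso (subIncl h)) (Iso.refl _))).2
      (embeddings_incl h)⟩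

theorem pr_mkSub (A : D.Pred φ.obj.base) (h : A ≤ φ.obj.pred) : pr (mkSub A h) = A := by
  -- The chosen representative of the subobject is only isomorphic to the inclusion of `A`. Upper
  -- bounds of the range are unaffected by precomposition with an isomorphism.
  have h1 : ∀ B : D.Pred φ.obj.base, pr (mkSub A h) ≤ B ↔ A ≤ B := fun B => by
    have h2 := mem_comp_iff (surjections_of_isIso (Subobject.underlyingIso (subIncl h)).inv)
      (a := (mkSub A h).1.arrow) (A := B)
    change Mem (_ ≫ (Subobject.mk (subIncl h)).arrow) B ↔ _ at h2
    rw [Subobject.underlyingIso_arrow] at h2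
    refine h2.symm.trans ?_
    rw [Mem]
    exact iff_of_eq (congrArg (· ≤ B) (im_incl h))
  exact le_antisymm ((h1 A).2 le_rfl) ((h1 _).1 le_rfl)

variable (φ) in
/-- Subobjects correspond to predicates. -/
def subIso : Set.Iic φ.obj.pred ≃o MSub D.embeddings φ where
  toFun A := mkSub A.1 A.2
  invFun S := ⟨pr S, pr_le S⟩
  left_inv A := Subtype.ext (pr_mkSub _ _)
  right_inv S := le_antisymm (msub_le_iff.2 (pr_mkSub _ _).le) (msub_le_iff.2 (pr_mkSub _ _).ge)
  map_rel_iff' := by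
    intro A B
    refine msub_le_iff.trans ?_
    change pr (mkSub A.1 A.2) ≤ pr (mkSub B.1 B.2) ↔ A.1 ≤ B.1
    exact iff_of_eq (congrArg₂ (· ≤ ·) (pr_mkSub _ _) (pr_mkSub _ _))

theorem pr_pull (f : φ ⟶ ψ) (S : MSub D.embeddings ψ) :
    pr (MSub.pull D.surjections D.embeddings f S) = preim f (pr S) := by
  have key : ∀ {T : D.SyntS4} (a : T ⟶ φ),
      Mem a (pr (MSub.pull D.surjections D.embeddings f S)) ↔ Mem a (preim f (pr S)) := by
    intro T a
    rw [mem_preim, ← factors_iff_mem, ← factors_iff_mem, factors_iff_exists, factors_iff_exists]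
    have sq := Subobject.isPullback f S.1
    constructor
    · rintro ⟨b, rfl⟩
      refine ⟨b ≫ Subobject.pullbackπ f S.1, ?_⟩
      exact (Category.assoc _ _ _).trans ((congrArg (b ≫ ·) sq.w).trans (Category.assoc _ _ _).symm)
    · rintro ⟨b, hb⟩
      exact ⟨sq.lift b a hb, sq.lift_snd _ _ _⟩
  exact le_antisymm ((le_iff_mem (pr_le _)).2 fun a h => (key a).1 h)
    ((le_iff_mem (preim_le f _)).2 fun a h => (key a).2 h)

/-- The factorization is an arbitrary choice, but its left part is a surjection, so it does not
affect the range. -/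
theorem pr_imageOf (f : T ⟶ φ) :
    pr (MSub.imageOf D.surjections D.embeddings f) = D.im (rel f) := by
  let F := MorphismProperty.factorizationData D.surjections D.embeddings f
  have := IsProperStable.mono (L := D.surjections) _ F.hp
  have h1 : ∀ B : D.Pred φ.obj.base, pr (MSub.imageOf D.surjections D.embeddings f) ≤ B ↔
      D.im (rel f) ≤ B := fun B => by
    have h2 : F.i ≫ (Subobject.underlyingIso F.p).inv ≫ (Subobject.mk F.p).arrow = f := by
      rw [Subobject.underlyingIso_arrow, F.fac]
    change Mem (Subobject.mk F.p).arrow B ↔ Mem f B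
    have h3 : Mem (F.i ≫ (Subobject.underlyingIso F.p).inv ≫ (Subobject.mk F.p).arrow) B ↔
        Mem f B := iff_of_eq (congrArg (Mem · B) h2)
    rw [← h3, mem_comp_iff F.hi, mem_comp_iff (surjections_of_isIso _)]
  exact le_antisymm ((h1 _).2 le_rfl) ((h1 _).1 le_rfl)

theorem pr_ex (f : φ ⟶ ψ) (S : MSub D.embeddings φ) :
    pr (MSub.ex D.surjections D.embeddings f S) = D.im (rel (S.1.arrow ≫ f)) := pr_imageOf _

theorem mem_pr_ex (f : φ ⟶ ψ) (S : MSub D.embeddings φ) {a : T ⟶ φ} (h : Mem a (pr S)) :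
    Mem (a ≫ f) (pr (MSub.ex D.surjections D.embeddings f S)) := by
  obtain ⟨b, rfl⟩ := factors_iff_exists.1 (factors_iff_mem.2 h)
  rw [pr_ex, Category.assoc]
  exact Mem.comp (a := S.1.arrow ≫ f) le_rfl b

/-- Existence on a cover: `q` is the pullback, along the given element, of the surjection from `S`
onto its image under `f`, and surjections are stable. -/
theorem exists_of_mem_pr_ex {f : φ ⟶ ψ} {S : MSub D.embeddings φ} {a : T ⟶ ψ}
    (h : Mem a (pr (MSub.ex D.surjections D.embeddings f S))) :
    ∃ (V : D.SyntS4) (q : V ⟶ T) (b : V ⟶ φ), D.surjections q ∧ Mem b (pr S) ∧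
      b ≫ f = q ≫ a := by
  rw [pr_ex] at h
  have sq := IsPullback.of_hasPullback (codRestrict a _ h) (toIm (S.1.arrow ≫ f))
  refine ⟨_, pullback.fst _ _, pullback.snd (codRestrict a _ h) (toIm (S.1.arrow ≫ f)) ≫ S.1.arrow,
    MorphismProperty.of_isPullback sq.flip (surjections_toIm _), Mem.comp (a := S.1.arrow) le_rfl _,
    ?_⟩
  have h1 := congrArg (· ≫ subIncl (im_rel_le (S.1.arrow ≫ f))) sq.w
  simp only [Category.assoc, toIm_incl] at h1
  rw [Category.assoc, ← h1]
  congr 1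
  exact codRestrict_incl _ _ _

/-! ### Boolean algebras of subobjects -/

instance : HasBooleanSub D.surjections D.embeddings where
  boolean φ :=
    letI := Set.Iic.booleanAlgebra φ.obj.pred
    .of_orderIso (subIso φ).symm

variable (φ) in
/-- The Boolean algebra of subobjects of `φ` consists of the predicates on `φ`. -/
def algIso : MSub.alg D.surjections D.embeddings φ ≃o Set.Iic φ.obj.pred := (subIso φ).symm

/-- The predicate corresponding to an element of the Boolean algebra of subobjects. -/
def algPr (S : MSub.alg D.surjections D.embeddings φ) : D.Pred φ.obj.base := (algIso φ S).1

theorem algPr_injective {S S' : MSub.alg D.surjections D.embeddings φ} (h : algPr S = algPr S') :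
    S = S' := (algIso φ).injective (Subtype.ext h)

/-- The operations on subobjects come from an arbitrary choice, but the order determines them, so an
order isomorphism preserves them. -/
theorem algPr_sup (S S' : MSub.alg D.surjections D.embeddings φ) :
    algPr (S ⊔ S') = algPr S ⊔ algPr S' := congrArg Subtype.val (map_sup (algIso φ) S S')

theorem algPr_inf (S S' : MSub.alg D.surjections D.embeddings φ) :
    algPr (S ⊓ S') = algPr S ⊓ algPr S' := congrArg Subtype.val (map_inf (algIso φ) S S')

theorem algPr_top : algPr (⊤ : MSub.alg D.surjections D.embeddings φ) = φ.obj.pred :=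
  congrArg Subtype.val (map_top (algIso φ))

theorem algPr_bot : algPr (⊥ : MSub.alg D.surjections D.embeddings φ) = ⊥ :=
  congrArg Subtype.val (map_bot (algIso φ))

/-- The inverse image map between Boolean algebras of subobjects. -/
def algPull (f : φ ⟶ ψ) (S : MSub.alg D.surjections D.embeddings ψ) :
    MSub.alg D.surjections D.embeddings φ := MSub.pull D.surjections D.embeddings f S

theorem algPr_algPull (f : φ ⟶ ψ) (S : MSub.alg D.surjections D.embeddings ψ) :
    algPr (algPull f S) = preim f (algPr S) := pr_pull f S

instance : IsFBoolean D.surjections D.embeddings where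
  pull_hom {φ ψ} f := by
    refine ⟨BoolAlg.ofHom (X := MSub.alg D.surjections D.embeddings ψ)
      (Y := MSub.alg D.surjections D.embeddings φ)
      { toFun := algPull f
        map_sup' := fun S S' => algPr_injective ?_
        map_inf' := fun S S' => algPr_injective ?_
        map_top' := algPr_injective ?_
        map_bot' := algPr_injective ?_ }, fun _ => rfl⟩
    · rw [algPr_sup, algPr_algPull, algPr_algPull, algPr_algPull, algPr_sup, preim_sup]
    · rw [algPr_inf, algPr_algPull, algPr_algPull, algPr_algPull, algPr_inf, preim_inf]
    · change algPr (algPull f ⊤) = algPr ⊤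
      rw [algPr_algPull, algPr_top, algPr_top, preim_pred]
    · change algPr (algPull f ⊥) = algPr ⊥
      rw [algPr_algPull, algPr_bot, algPr_bot, preim_bot]

variable (D) in
/-- The doctrine of subobjects. -/
abbrev sub : ExistentialDoctrine D.SyntS4 := subDoctrine D.surjections D.embeddings

/-- The predicate corresponding to a subobject. -/
def und (S : (sub D).Pred φ) : D.Pred φ.obj.base := pr (φ := φ) S

theorem und_le (S : (sub D).Pred φ) : und S ≤ φ.obj.pred := pr_le _

theorem le_iff_und {S S' : (sub D).Pred φ} : S ≤ S' ↔ und S ≤ und S' :=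
  msub_le_iff (S := S) (S' := S')

theorem und_inf (S S' : (sub D).Pred φ) : und (S ⊓ S') = und S ⊓ und S' := algPr_inf S S'

theorem und_sup (S S' : (sub D).Pred φ) : und (S ⊔ S') = und S ⊔ und S' := algPr_sup S S'

theorem und_bot : und (⊥ : (sub D).Pred φ) = ⊥ := algPr_bot

theorem sub_pull (f : φ ⟶ ψ) (S : (sub D).Pred ψ) :
    (sub D).pull f S = MSub.pull D.surjections D.embeddings f S :=
  (IsFBoolean.pull_hom (L := D.surjections) (M := D.embeddings) f).choose_spec S

theorem mem_und_pull {f : φ ⟶ ψ} {S : (sub D).Pred ψ} {a : T ⟶ φ} :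
    Mem a (und ((sub D).pull f S)) ↔ Mem (a ≫ f) (und S) := by
  rw [sub_pull, ← mem_preim]
  exact iff_of_eq (congrArg (Mem a) (pr_pull f S))

theorem mem_und_ex (f : φ ⟶ ψ) (S : (sub D).Pred φ) {a : T ⟶ φ} (h : Mem a (und S)) :
    Mem (a ≫ f) (und ((sub D).ex f S)) :=
  mem_pr_ex f S h

theorem exists_of_mem_und_ex {f : φ ⟶ ψ} {S : (sub D).Pred φ} {a : T ⟶ ψ}
    (h : Mem a (und ((sub D).ex f S))) :
    ∃ (V : D.SyntS4) (q : V ⟶ T) (b : V ⟶ φ), D.surjections q ∧ Mem b (und S) ∧ b ≫ f = q ≫ a :=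
  exists_of_mem_pr_ex h

variable (D) in
/-- The operators on subobjects. -/
def subDia (φ : D.SyntS4) (S : (sub D).Pred φ) : (sub D).Pred φ :=
  subIso φ ⟨φ.obj.pred ⊓ D.dia φ.obj.base ((subIso φ).symm S).1, inf_le_left⟩

theorem und_subDia (S : (sub D).Pred φ) :
    und (subDia D φ S) = φ.obj.pred ⊓ D.dia _ (und S) := pr_mkSub _ _

theorem mem_und_subDia {S : (sub D).Pred φ} {a : T ⟶ φ} :
    Mem a (und (subDia D φ S)) ↔ Mem a (D.dia _ (und S)) := by
  rw [und_subDia, mem_inf]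
  exact and_iff_right (mem_pred a)

theorem sub_le_iff {S S' : (sub D).Pred φ} :
    S ≤ S' ↔ ∀ {T : D.SyntS4} (a : T ⟶ φ), Mem a (und S) → Mem a (und S') :=
  le_iff_und.trans (le_iff_mem (und_le S))

end Subobjects

/-! ### The modal structure -/

section Modal

variable {T φ ψ : D.SyntS4}

/-- Composing with an inclusion leaves the relation unchanged. Thus a predicate of the form `◇B` on
the base does not distinguish an element of `A` from the same element of `φ`. -/
theorem mem_comp_subIncl {A : D.Pred φ.obj.base} (hA : A ≤ φ.obj.pred) {a : T ⟶ SyntS4.of D A}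
    {B : D.Pred φ.obj.base} : Mem (a ≫ subIncl hA) B ↔ Mem (φ := SyntS4.of D A) a B := by
  have h : rel (a ≫ subIncl hA) = rel a := D.relComp_restrict_id (im_rel_le a)
  rw [Mem, Mem]
  exact iff_of_eq (congrArg (fun R => D.im R ≤ B) h)

theorem subDia_lax (f : φ ⟶ ψ) (S : (sub D).Pred ψ) :
    subDia D φ ((sub D).pull f S) ≤ (sub D).pull f (subDia D ψ S) := by
  rw [sub_le_iff]
  intro T a h
  rw [mem_und_subDia] at h
  rw [mem_und_pull, mem_und_subDia]
  exact h.dia_comp f (und_le _) fun a ha => mem_und_pull.1 ha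

/-- One inequality is continuity of `m`. For the other, `m` is an isomorphism onto its range, the
direct image of `S` lies in this range, and continuity of the inverse carries `◇` back. -/
theorem subDia_embedding (m : φ ⟶ ψ) (hm : D.embeddings m) (S : (sub D).Pred φ) :
    subDia D φ S = (sub D).pull m (subDia D ψ ((sub D).ex m S)) := by
  apply le_antisymm <;> rw [sub_le_iff] <;> intro T a h
  · rw [mem_und_subDia] at h
    rw [mem_und_pull, mem_und_subDia]
    exact h.dia_comp m (und_le _) fun a ha => mem_und_ex m S ha
  · rw [mem_und_pull, mem_und_subDia] at h
    rw [mem_und_subDia]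
    have := isIso_toIm (f := m) (by rwa [← embeddings_eq])
    have ex_le : und ((sub D).ex m S) ≤ D.im (rel m) := by
      rw [le_iff_mem (und_le _)]
      intro V c hc
      obtain ⟨U, q, b, hq, -, e⟩ := exists_of_mem_und_ex hc
      rw [← mem_comp_iff hq, ← e]
      exact Mem.comp (a := m) le_rfl b
    rw [← toIm_incl m, ← Category.assoc, mem_comp_subIncl] at h
    have h1 : Mem ((a ≫ toIm m) ≫ inv (toIm m)) (D.dia _ (und S)) := by
      refine h.dia_comp _ ?_ ?_
      · rwa [toIm_incl]
      · intro V c hc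
        rw [← mem_comp_subIncl (im_rel_le m), toIm_incl] at hc
        obtain ⟨U, q, b, hq, hb, e⟩ := exists_of_mem_und_ex hc
        have e' : b ≫ toIm m = q ≫ c := by
          rw [← cancel_mono (subIncl (im_rel_le m)), Category.assoc, toIm_incl, e, Category.assoc]
        rwa [← mem_comp_iff hq, ← Category.assoc, ← e', Category.assoc, IsIso.hom_inv_id,
          Category.comp_id]
    simpa using h1

/-- The axiom of the doctrine concerns `tensor φ ψ`; continuity of the comparison map to the
categorical product transports it. -/
theorem subDia_productIndependence : (sub D).ProductIndependence (subDia D) := by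
  intro φ ψ S S'
  rw [sub_le_iff]
  intro T a h
  rw [und_inf, mem_inf, mem_und_pull, mem_und_pull, mem_und_subDia, mem_und_subDia] at h
  have h1 : Mem (pair (a ≫ prod.fst) (a ≫ prod.snd))
      (D.dia _ (D.pull prod.fst (und S) ⊓ D.pull prod.snd (und S'))) := by
    refine Mem.mono (mem_inf.2 ⟨?_, ?_⟩) (D.product_independence _ _ (und S) (und S'))
    · rw [← mem_mapGraph (ψ := φ) (hf := inf_le_left)]
      change Mem (_ ≫ proj₁ φ ψ) _
      rw [pair_proj₁]
      exact h.1
    · rw [← mem_mapGraph (ψ := ψ) (hf := inf_le_right)]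
      change Mem (_ ≫ proj₂ φ ψ) _
      rw [pair_proj₂]
      exact h.2
  have h2 := h1.dia_comp (prod.lift (proj₁ φ ψ) (proj₂ φ ψ))
    (B := und ((sub D).pull prod.fst S ⊓ (sub D).pull prod.snd S'))
    (inf_le_inf (D.pull_mono _ (und_le S)) (D.pull_mono _ (und_le S'))) (by
      intro V c hc
      rw [mem_inf, ← mem_mapGraph (ψ := φ) (hf := inf_le_left),
        ← mem_mapGraph (ψ := ψ) (hf := inf_le_right)] at hc
      rw [und_inf, mem_inf, mem_und_pull, mem_und_pull, Category.assoc, Category.assoc,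
        prod.lift_fst, prod.lift_snd]
      exact hc)
  rw [mem_und_subDia]
  convert h2 using 1
  apply Limits.prod.hom_ext <;> simp [pair_proj₁, pair_proj₂, prod.lift_fst, prod.lift_snd]

theorem isTopologicalModalCategory_of_loopContraction
    (h : (sub D).LoopContraction (subDia D) (partialMaps D.surjections D.embeddings)) :
    IsTopologicalModalCategory D.surjections D.embeddings (subDia D) where
  dia_bot φ := le_antisymm (le_iff_und.2 (by
    rw [und_subDia, und_bot, D.dia_bot]
    exact inf_le_right)) bot_le
  dia_sup φ S S' := by
    have e : und (subDia D φ (S ⊔ S')) = und (subDia D φ S ⊔ subDia D φ S') := by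
      rw [und_sup, und_subDia, und_subDia, und_subDia, und_sup, D.dia_sup, inf_sup_left]
    exact le_antisymm (le_iff_und.2 e.le) (le_iff_und.2 e.ge)
  lax := subDia_lax
  embedding := subDia_embedding
  le_dia φ S := le_iff_und.2 (by
    rw [und_subDia]
    exact le_inf (und_le S) (D.le_dia _ _))
  dia_dia φ S := by
    have e : und (subDia D φ (subDia D φ S)) = und (subDia D φ S) := by
      rw [und_subDia, und_subDia]
      refine le_antisymm (inf_le_inf_left _ ?_) (le_inf inf_le_left (D.le_dia _ _))
      rw [← D.dia_dia _ (und S)]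
      refine (dia_mono _ inf_le_right).trans ?_
      rw [D.dia_dia]
    exact le_antisymm (le_iff_und.2 e.le) (le_iff_und.2 e.ge)
  product_independence := subDia_productIndependence
  loop_contraction := h

end Modal

end TopologicalModalDoctrine

/-! ### Sequences of relations padded by identities -/

namespace ExistentialDoctrine

variable {C : Type u} [Category.{v} C] [HasFiniteProducts C] {P : ExistentialDoctrine.{w} C}

theorem RelSeq.append_assoc {X Y Z T : C} (s : P.RelSeq Z T) (t : P.RelSeq Y Z)
    (r : P.RelSeq X Y) : (s.append t).append r = s.append (t.append r) := by
  induction s with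
  | nil => rfl
  | cons R s ih => exact congrArg (RelSeq.cons R) ih

/-- `Padding s t`: the sequence `t` arises from `s` by the insertion of identity relations. -/
inductive RelSeq.Padding : ∀ {X Y : C}, P.RelSeq X Y → P.RelSeq X Y → Prop
  | nil (X : C) : Padding (.nil X) (.nil X)
  | cons {X Y Z : C} (R : P.Pred (Y ⨯ Z)) {s t : P.RelSeq X Y} :
      Padding s t → Padding (.cons R s) (.cons R t)
  | insert_id {X Y : C} {s t : P.RelSeq X Y} : Padding s t → Padding s (.cons (P.idRel Y) t)

/-- Acceptability concerns a whole loop while padding recurses on the tail, so the members already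
passed are collected in the prefix `r`. -/
theorem RelSeq.Padding.acceptable {K : ∀ X Y : C, Set (P.Pred (X ⨯ Y))} {X Y : C}
    {s t : P.RelSeq X Y} (h : Padding s t) (r : P.RelSeq Y X) (hs : Acceptable K (r.append s)) :
    Acceptable K (r.append t) := by
  induction h with
  | nil => exact hs
  | cons R _ ih =>
    have h1 := ih (r.append (.cons R (.nil _)))
    rw [append_assoc, append_assoc] at h1
    exact h1 hs
  | insert_id _ ih => exact .insert_id _ _ (ih r hs)

end ExistentialDoctrine

namespace TopologicalModalDoctrine

open BooleanDoctrine ExistentialDoctrine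

variable {C : Type u} [Category.{v} C] [HasFiniteProducts C] {D : TopologicalModalDoctrine.{w} C}

/-! ### Loops -/

section Loops

variable {T φ ψ φ' ψ' : D.SyntS4} {X Y Z X' Y' : C}

variable (D) in
/-- An object of the base category, as an object of the syntactic category. -/
abbrev full (X : C) : D.SyntS4 := SyntS4.of D (⊤ : D.Pred X)

/-- A morphism of the base category, as a morphism of the syntactic category. -/
def fullMap (f : X ⟶ Y) : full D X ⟶ full D Y := mapGraph f (D.pull_top f).ge

theorem mem_fullMap {a : T ⟶ full D X} {f : X ⟶ Y} {B : D.Pred Y} :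
    Mem (φ := full D Y) (a ≫ fullMap f) B ↔ Mem (φ := full D X) a (D.pull f B) :=
  mem_mapGraph (φ := full D X) (ψ := full D Y)

/-- The embedding of an object. -/
def emb (φ : D.SyntS4) : φ ⟶ full D φ.obj.base := SyntS4.incl D le_top

theorem embeddings_emb (φ : D.SyntS4) : D.embeddings (emb φ) := embeddings_incl _

theorem incl_eq_mapGraph {A B : D.Pred X} (h : A ≤ B) : SyntS4.incl D h =
    mapGraph (φ := SyntS4.of D A) (ψ := SyntS4.of D B) (𝟙 X) (h.trans (D.pull_id B).ge) := by
  refine hom_ext_of_ev fun a x y h1 => ?_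
  rw [ev_rel_incl] at h1
  rw [ev_rel_mapGraph, Category.comp_id]
  exact h1

/-- The pairing of maps to objects of the base category. -/
def fullPair (a : T ⟶ full D X) (b : T ⟶ full D Y) : T ⟶ full D (X ⨯ Y) := pair a b ≫ emb _

theorem emb_eq_mapGraph (φ : D.SyntS4) : emb φ =
    mapGraph (φ := φ) (ψ := full D φ.obj.base) (𝟙 _) (le_top.trans (D.pull_top _).ge) :=
  incl_eq_mapGraph le_top

theorem emb_fst : emb (tensor φ ψ) ≫ fullMap prod.fst = proj₁ φ ψ ≫ emb φ := by
  rw [emb_eq_mapGraph, emb_eq_mapGraph, fullMap, proj₁, mapGraph_comp _ _ _ _ (le_top.trans (D.pull_top _).ge),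
    mapGraph_comp _ _ _ _ (le_top.trans (D.pull_top _).ge)]
  congr 1
  simp

theorem emb_snd : emb (tensor φ ψ) ≫ fullMap prod.snd = proj₂ φ ψ ≫ emb ψ := by
  rw [emb_eq_mapGraph, emb_eq_mapGraph, fullMap, proj₂, mapGraph_comp _ _ _ _ (le_top.trans (D.pull_top _).ge),
    mapGraph_comp _ _ _ _ (le_top.trans (D.pull_top _).ge)]
  congr 1
  simp

theorem emb_full : emb (full D X) = 𝟙 _ := rfl

theorem fullPair_fst (a : T ⟶ full D X) (b : T ⟶ full D Y) :
    fullPair a b ≫ fullMap prod.fst = a := by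
  have h := emb_fst (φ := full D X) (ψ := full D Y)
  rw [emb_full, Category.comp_id] at h
  rw [fullPair, Category.assoc]
  exact (congrArg (pair a b ≫ ·) h).trans (pair_proj₁ a b)

theorem fullPair_snd (a : T ⟶ full D X) (b : T ⟶ full D Y) :
    fullPair a b ≫ fullMap prod.snd = b := by
  have h := emb_snd (φ := full D X) (ψ := full D Y)
  rw [emb_full, Category.comp_id] at h
  rw [fullPair, Category.assoc]
  exact (congrArg (pair a b ≫ ·) h).trans (pair_proj₂ a b)

theorem fullMap_comp (f : X ⟶ Y) (g : Y ⟶ Z) : fullMap (D := D) f ≫ fullMap g = fullMap (f ≫ g) :=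
  mapGraph_comp _ _ _ _ _

theorem full_hom_ext {a b : T ⟶ full D (X ⨯ Y)} (h₁ : a ≫ fullMap prod.fst = b ≫ fullMap prod.fst)
    (h₂ : a ≫ fullMap prod.snd = b ≫ fullMap prod.snd) : a = b := by
  have h : ∀ c : T ⟶ full D (X ⨯ Y),
      c = fullPair (c ≫ fullMap prod.fst) (c ≫ fullMap prod.snd) := fun c => by
    -- The predicate of the tensor equals `⊤` only propositionally, so the target of `c` has to be
    -- changed.
    let c' : T ⟶ tensor (full D X) (full D Y) := codRestrict c _ (by
      rw [D.pull_top, D.pull_top, inf_top_eq]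
      exact mem_top c)
    have hc : c' ≫ emb _ = c := codRestrict_incl (φ := full D (X ⨯ Y)) c _ le_top
    rw [fullPair, ← hc, Category.assoc, Category.assoc, emb_fst, emb_snd, emb_full, emb_full,
      Category.comp_id, Category.comp_id, ← eq_pair]
  rw [h a, h b, h₁, h₂]

theorem comp_fullPair {T' : D.SyntS4} (k : T' ⟶ T) (a : T ⟶ full D X) (b : T ⟶ full D Y) :
    k ≫ fullPair a b = fullPair (k ≫ a) (k ≫ b) := by
  apply full_hom_ext <;> simp only [Category.assoc, fullPair_fst, fullPair_snd]

theorem fullPair_fullMap_lift {V : C} (a : T ⟶ full D V) (f : V ⟶ X) (g : V ⟶ Y) :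
    a ≫ fullMap (prod.lift f g) = fullPair (a ≫ fullMap f) (a ≫ fullMap g) := by
  apply full_hom_ext <;>
    simp only [Category.assoc, fullPair_fst, fullPair_snd, fullMap_comp, prod.lift_fst,
      prod.lift_snd]

/-- `R(a, b)` for generalized elements of objects of the base category. -/
def Holds (R : D.Pred (X ⨯ Y)) (a : T ⟶ full D X) (b : T ⟶ full D Y) : Prop :=
  Mem (φ := full D (X ⨯ Y)) (fullPair a b) R

theorem Holds.comp {R : D.Pred (X ⨯ Y)} {a : T ⟶ full D X} {b : T ⟶ full D Y} (h : Holds R a b)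
    {T' : D.SyntS4} (k : T' ⟶ T) : Holds R (k ≫ a) (k ≫ b) := by
  rw [Holds, ← comp_fullPair]
  exact Mem.comp h k

theorem holds_pull_lift {V : C} {R : D.Pred (X ⨯ Y)} {a : T ⟶ full D V} (f : V ⟶ X) (g : V ⟶ Y) :
    Mem (φ := full D V) a (D.pull (prod.lift f g) R) ↔ Holds R (a ≫ fullMap f) (a ≫ fullMap g) := by
  rw [← mem_fullMap, fullPair_fullMap_lift, Holds]

theorem holds_idRel (a : T ⟶ full D X) : Holds (D.idRel X) a a := by
  have h : Mem (φ := full D X) a (D.pull (prod.lift (𝟙 X) (𝟙 X)) (D.idRel X)) :=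
    (mem_top a).mono (D.le_pull_ex (diag X) ⊤)
  rw [holds_pull_lift] at h
  have e : fullMap (D := D) (𝟙 X) = 𝟙 _ := (incl_eq_mapGraph le_rfl).symm
  rwa [e, Category.comp_id] at h

theorem holds_conv {R : D.Pred (X ⨯ Y)} {a : T ⟶ full D X} {b : T ⟶ full D Y} :
    Holds (D.conv R) b a ↔ Holds R a b := by
  rw [Holds, ExistentialDoctrine.conv, holds_pull_lift, fullPair_fst, fullPair_snd]

theorem holds_relProd {R : D.Pred (X ⨯ Y)} {S : D.Pred (X' ⨯ Y')} {a : T ⟶ full D X}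
    {b : T ⟶ full D Y} {a' : T ⟶ full D X'} {b' : T ⟶ full D Y'} :
    Holds (D.relProd R S) (fullPair a a') (fullPair b b') ↔ Holds R a b ∧ Holds S a' b' := by
  rw [Holds, ExistentialDoctrine.relProd, mem_inf]
  have h : ∀ {V W V' W' : C} (f : V ⟶ W) (g : V' ⟶ W'),
      prod.map f g = prod.lift (prod.fst ≫ f) (prod.snd ≫ g) := fun f g => by ext <;> simp
  rw [h, h, holds_pull_lift, holds_pull_lift]
  simp only [← fullMap_comp, ← Category.assoc, fullPair_fst, fullPair_snd]

theorem Holds.mem_image {R : D.Pred (X ⨯ Y)} {a : T ⟶ full D X} {b : T ⟶ full D Y} {A : D.Pred X}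
    (h : Holds R a b) (ha : Mem (φ := full D X) a A) : Mem (φ := full D Y) b (D.image R A) := by
  have h1 : Mem (φ := full D (X ⨯ Y)) (fullPair a b)
      (D.pull prod.snd (D.image R A)) := by
    refine Mem.mono (mem_inf.2 ⟨h, ?_⟩) (D.le_pull_ex prod.snd (R ⊓ D.pull prod.fst A))
    rwa [← mem_fullMap, fullPair_fst]
  rwa [← mem_fullMap, fullPair_snd] at h1

/-- `R(a, b)` for generalized elements of the syntactic category. -/
def SubHolds (R : (sub D).Pred (φ ⨯ ψ)) (a : T ⟶ φ) (b : T ⟶ ψ) : Prop := Mem (prod.lift a b) (und R)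

theorem SubHolds.of_mem {R : (sub D).Pred (φ ⨯ ψ)} {r : T ⟶ φ ⨯ ψ} (h : Mem r (und R)) :
    SubHolds R (r ≫ prod.fst) (r ≫ prod.snd) := by
  rwa [SubHolds, ← prod.comp_lift, prod.lift_fst_snd, Category.comp_id]

theorem SubHolds.conv {R : (sub D).Pred (φ ⨯ ψ)} {a : T ⟶ φ} {b : T ⟶ ψ}
    (h : SubHolds ((sub D).conv R) b a) : SubHolds R a b := by
  rw [SubHolds, ExistentialDoctrine.conv, mem_und_pull, prod.comp_lift, prod.lift_fst,
    prod.lift_snd] at h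
  exact h

theorem SubHolds.relProd {R : (sub D).Pred (φ ⨯ ψ)} {S : (sub D).Pred (φ' ⨯ ψ')} {a : T ⟶ φ ⨯ φ'}
    {b : T ⟶ ψ ⨯ ψ'} (h : SubHolds ((sub D).relProd R S) a b) :
    SubHolds R (a ≫ prod.fst) (b ≫ prod.fst) ∧ SubHolds S (a ≫ prod.snd) (b ≫ prod.snd) := by
  rw [SubHolds, ExistentialDoctrine.relProd, und_inf, mem_inf, mem_und_pull, mem_und_pull,
    prod.lift_map, prod.lift_map] at h
  exact h

/-- Equality holds after a cover, and covers are epimorphisms. -/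
theorem SubHolds.idRel {a b : T ⟶ φ} (h : SubHolds ((sub D).idRel φ) a b) : a = b := by
  obtain ⟨V, q, x, hq, -, e⟩ := exists_of_mem_und_ex h
  have := epi_of_surjections hq
  have h₁ := congrArg (· ≫ prod.fst) e
  have h₂ := congrArg (· ≫ prod.snd) e
  simp only [Category.assoc, prod.lift_fst, prod.lift_snd, Category.comp_id] at h₁ h₂
  rw [← cancel_epi q, ← h₁, ← h₂]

/-- The relation `R` is contained in `S` along the maps `g` and `g'`. -/
def Contained (R : (sub D).Pred (φ ⨯ ψ)) (S : D.Pred (X ⨯ Y)) (g : φ ⟶ full D X)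
    (g' : ψ ⟶ full D Y) : Prop :=
  ∀ {T : D.SyntS4} (a : T ⟶ φ) (b : T ⟶ ψ), SubHolds R a b → Holds S (a ≫ g) (b ≫ g')

theorem Contained.conv {R : (sub D).Pred (φ ⨯ ψ)} {S : D.Pred (X ⨯ Y)} {g : φ ⟶ full D X}
    {g' : ψ ⟶ full D Y} (h : Contained R S g g') : Contained ((sub D).conv R) (D.conv S) g' g :=
  fun _ _ hr => holds_conv.2 (h _ _ hr.conv)

theorem contained_idRel (g : φ ⟶ full D X) : Contained ((sub D).idRel φ) (D.idRel X) g g :=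
  fun a b h => by
    rw [h.idRel]
    exact holds_idRel _

/-- The product of two maps to objects of the base category. -/
def fullProd (g : φ ⟶ full D X) (h : ψ ⟶ full D Y) : φ ⨯ ψ ⟶ full D (X ⨯ Y) :=
  fullPair (prod.fst ≫ g) (prod.snd ≫ h)

theorem comp_fullProd (a : T ⟶ φ ⨯ ψ) (g : φ ⟶ full D X) (h : ψ ⟶ full D Y) :
    a ≫ fullProd g h = fullPair ((a ≫ prod.fst) ≫ g) ((a ≫ prod.snd) ≫ h) := by
  rw [fullProd, comp_fullPair, Category.assoc, Category.assoc]

theorem Contained.relProd {R : (sub D).Pred (φ ⨯ ψ)} {S : (sub D).Pred (φ' ⨯ ψ')}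
    {R' : D.Pred (X ⨯ Y)} {S' : D.Pred (X' ⨯ Y')} {g : φ ⟶ full D X} {h : ψ ⟶ full D Y}
    {g' : φ' ⟶ full D X'} {h' : ψ' ⟶ full D Y'} (hR : Contained R R' g h)
    (hS : Contained S S' g' h') :
    Contained ((sub D).relProd R S) (D.relProd R' S') (fullProd g g') (fullProd h h') :=
  fun a b hab => by
    rw [comp_fullProd, comp_fullProd, holds_relProd]
    exact ⟨hR _ _ hab.relProd.1, hS _ _ hab.relProd.2⟩

theorem embeddings_fullProd_emb (φ ψ : D.SyntS4) : D.embeddings (fullProd (emb φ) (emb ψ)) := by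
  have e : fullProd (emb φ) (emb ψ) = pair prod.fst prod.snd ≫ emb (tensor φ ψ) := by
    apply full_hom_ext <;> rw [Category.assoc]
    · rw [emb_fst, ← Category.assoc, pair_proj₁, fullProd, fullPair_fst]
    · rw [emb_snd, ← Category.assoc, pair_proj₂, fullProd, fullPair_snd]
  have : IsIso (pair (prod.fst : φ ⨯ ψ ⟶ φ) prod.snd) :=
    ⟨prod.lift (proj₁ φ ψ) (proj₂ φ ψ), by
      apply Limits.prod.hom_ext <;> simp [pair_proj₁, pair_proj₂, prod.lift_fst, prod.lift_snd], by
      apply tensor_hom_ext <;> simp [pair_proj₁, pair_proj₂, prod.lift_fst, prod.lift_snd]⟩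
  rw [e, embeddings_eq]
  exact D.surjections.rlp.comp_mem _ _ (MorphismProperty.rlp_of_isIso _ _)
    (by rw [← embeddings_eq]; exact embeddings_emb _)

/-- The graph of a partial map is contained in a distinguished partial map. -/
theorem exists_cont_holds {d : T ⟶ full D X} (hd : D.embeddings d) (t : T ⟶ full D Y) :
    ∃ R ∈ D.cont X Y, Holds R d t := by
  -- The inverse of `d` on its range is continuous, so the partial map with graph `(d, t)` is a
  -- continuous map on that range, and this is contained in a distinguished `R`.
  have := isIso_toIm (f := d) (by rwa [← embeddings_eq])
  obtain ⟨R, hR, e⟩ := exists_cont (inv (toIm d) ≫ t)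
  refine ⟨R, hR, ?_⟩
  have h : Mem (φ := tensor (full D X) (full D Y)) (pair d t) R := by
    rw [mem_iff]
    intro W c x y hc
    rw [ev_rel_pair] at hc
    have h1 : c ≤ D.ev (rel (toIm d ≫ inv (toIm d) ≫ t)) x (y ≫ prod.snd) := by
      rw [IsIso.hom_inv_id_assoc]
      exact hc.trans inf_le_right
    refine rel_comp_cases h1 fun p z b h2 h3 h4 => ?_
    have h5 : b ≤ D.ev (rel d) (p ≫ x) (p ≫ y ≫ prod.fst) :=
      D.le_ev_of_le_pull h2 (hc.trans inf_le_left)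
    have h6 := D.eq_subst _ (rel_unique (f := d) h3 h5) h4
    rw [e, ev_restrict] at h6
    refine (h6.trans inf_le_right).trans (le_of_eq ?_)
    rw [ev, D.pull_pull]
    congr 1
    apply Limits.prod.hom_ext <;> simp [prod.lift_fst, prod.lift_snd]
  exact (mem_comp_subIncl (φ := full D (X ⨯ Y)) le_top).2 h

/-- `Dominated s t g h`: the sequence `s` of relations of the syntactic category is dominated along
`g` and `h` by the sequence `t` of relations of the doctrine, which may have additional members. -/
inductive Dominated : ∀ {φ ψ : D.SyntS4} {X Y : C}, (sub D).RelSeq φ ψ → D.RelSeq X Y →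
    (φ ⟶ full D X) → (ψ ⟶ full D Y) → Prop
  | nil {φ : D.SyntS4} {X : C} (h : φ ⟶ full D X) : Dominated (.nil φ) (.nil X) h h
  | cons {φ ψ θ : D.SyntS4} {X Y Z : C} {s : (sub D).RelSeq φ ψ} {t : D.RelSeq X Y}
      {h : φ ⟶ full D X} {g : ψ ⟶ full D Y} {k : θ ⟶ full D Z} {R : (sub D).Pred (ψ ⨯ θ)}
      {S : D.Pred (Y ⨯ Z)} : Contained R S g k → Dominated s t h g →
      Dominated (.cons R s) (.cons S t) h k
  | skip {φ ψ : D.SyntS4} {X Y Z : C} {s : (sub D).RelSeq φ ψ} {t : D.RelSeq X Y}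
      {h : φ ⟶ full D X} {g : ψ ⟶ full D Y} {k : ψ ⟶ full D Z} {S : D.Pred (Y ⨯ Z)} :
      Holds S g k → Dominated s t h g → Dominated s (.cons S t) h k

/-- For a matched member, continuity of `k` passes `◇` across, and the direct image is handled on a
cover. For an additional member, each element is related to its own image, and `A ≤ ◇A` absorbs the
extra operator. -/
theorem Dominated.eval {s : (sub D).RelSeq φ ψ} {t : D.RelSeq X Y} {h : φ ⟶ full D X}
    {g : ψ ⟶ full D Y} (H : Dominated s t h g) {S : (sub D).Pred φ} {A : D.Pred X}
    (hS : ∀ {T : D.SyntS4} (a : T ⟶ φ), Mem a (und S) → Mem (φ := full D X) (a ≫ h) A)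
    {T : D.SyntS4} (b : T ⟶ ψ) (hb : Mem b (und (s.eval (subDia D) S))) :
    Mem (φ := full D Y) (b ≫ g) (t.eval D.dia A) := by
  induction H generalizing T with
  | nil h => exact hS b hb
  | @cons ψ θ X Y Z s t h g k R Q hR _ ih =>
    rw [RelSeq.eval, mem_und_subDia] at hb
    refine hb.dia_comp k (und_le _) fun c hc => ?_
    obtain ⟨V, q, r, hq, hr, e⟩ := exists_of_mem_und_ex hc
    rw [und_inf, mem_inf, mem_und_pull] at hr
    have h1 := (hR _ _ (SubHolds.of_mem hr.1)).mem_image (ih hS _ hr.2)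
    rw [e, Category.assoc, mem_comp_iff hq] at h1
    exact h1
  | @skip ψ X Y Z s t h g k Q hR _ ih =>
    exact ((hR.comp b).mem_image (ih hS b hb)).mono (D.le_dia _ _)

theorem Dominated.append {θ : D.SyntS4} {s : (sub D).RelSeq ψ θ} {t : D.RelSeq Y Z}
    {s' : (sub D).RelSeq φ ψ} {t' : D.RelSeq X Y} {h : φ ⟶ full D X} {g : ψ ⟶ full D Y}
    {k : θ ⟶ full D Z} (H : Dominated s t g k) (H' : Dominated s' t' h g) :
    Dominated (s.append s') (t.append t') h k := by
  induction H with
  | nil => exact H'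
  | cons hR _ ih => exact .cons hR (ih H')
  | skip hR _ ih => exact .skip hR (ih H')

/-- Changes the map at the source at the cost of one additional member, as `skip` does at the
target. Together they conjugate a dominating loop. -/
theorem Dominated.append_of_holds {s : (sub D).RelSeq φ ψ} {t : D.RelSeq X Z} {g : φ ⟶ full D X}
    {k : ψ ⟶ full D Z} (H : Dominated s t g k) {h : φ ⟶ full D Y} {R : D.Pred (Y ⨯ X)}
    (hR : Holds R h g) : Dominated s (t.append (.cons R (.nil Y))) h k := by
  induction H with
  | nil => exact .skip hR (.nil h)
  | cons hQ _ ih => exact .cons hQ (ih hR)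
  | skip hQ _ ih => exact .skip hQ (ih hR)

/-- Locates the place in `t` for an identity inserted in the dominated sequence. Additional members
situated at the cut go to `t₁`. -/
theorem Dominated.exists_of_append {u : (sub D).RelSeq φ ψ} {t : D.RelSeq X Y} {h : φ ⟶ full D X}
    {g : ψ ⟶ full D Y} (H : Dominated u t h g) {θ : D.SyntS4} (s₁ : (sub D).RelSeq θ ψ)
    (s₂ : (sub D).RelSeq φ θ) (e : u = s₁.append s₂) :
    ∃ (Z : C) (k : θ ⟶ full D Z) (t₁ : D.RelSeq Z Y) (t₂ : D.RelSeq X Z),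
      t = t₁.append t₂ ∧ Dominated s₁ t₁ k g ∧ Dominated s₂ t₂ h k := by
  induction H generalizing θ with
  | nil h =>
    cases s₁ with
    | nil =>
      refine ⟨_, h, .nil _, .nil _, rfl, .nil h, ?_⟩
      rw [RelSeq.append] at e
      exact e ▸ .nil h
    | cons R s => cases e
  | @cons ψ ψ' X Y Y' s t h g k R S hR H ih =>
    cases s₁ with
    | nil =>
      refine ⟨_, k, .nil _, .cons S t, rfl, .nil k, ?_⟩
      rw [RelSeq.append] at e
      exact e ▸ .cons hR H
    | cons Q s =>
      cases e
      obtain ⟨Z, l, t₁, t₂, rfl, H₁, H₂⟩ := ih s s₂ rfl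
      exact ⟨Z, l, .cons S t₁, t₂, rfl, .cons hR H₁, H₂⟩
  | @skip ψ X Y Y' s t h g k S hR H ih =>
    obtain ⟨Z, l, t₁, t₂, rfl, H₁, H₂⟩ := ih s₁ s₂ e
    exact ⟨Z, l, .cons S t₁, t₂, rfl, .skip hR H₁, H₂⟩

/-- Two sequences have paddings the product of which dominates a given sequence. -/
def ProdDominated (r : (sub D).RelSeq φ ψ) (t : D.RelSeq X Y) (t' : D.RelSeq X' Y')
    (h : φ ⟶ full D (X ⨯ X')) (g : ψ ⟶ full D (Y ⨯ Y')) : Prop :=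
  ∃ (p : D.RelSeq X Y) (p' : D.RelSeq X' Y') (q : D.RelSeq (X ⨯ X') (Y ⨯ Y')),
    t.Padding p ∧ t'.Padding p' ∧ RelSeq.IsProd p p' q ∧ Dominated r q h g

/-- The additional member on one side is paired with an inserted identity relation on the other. -/
theorem ProdDominated.skip_left {r : (sub D).RelSeq φ (ψ ⨯ ψ')} {t : D.RelSeq X Y}
    {t' : D.RelSeq X' Y'} {h : φ ⟶ full D (X ⨯ X')} {g : ψ ⟶ full D Y} {g' : ψ' ⟶ full D Y'}
    {k : ψ ⟶ full D Z} {S : D.Pred (Y ⨯ Z)} (hS : Holds S g k)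
    (H : ProdDominated r t t' h (fullProd g g')) :
    ProdDominated r (.cons S t) t' h (fullProd k g') := by
  obtain ⟨p, p', q, hp, hp', hq, H⟩ := H
  refine ⟨_, _, _, .cons S hp, .insert_id hp', .cons S (D.idRel _) hq, .skip ?_ H⟩
  exact holds_relProd.2 ⟨hS.comp _, holds_idRel _⟩

theorem ProdDominated.skip_right {r : (sub D).RelSeq φ (ψ ⨯ ψ')} {t : D.RelSeq X Y}
    {t' : D.RelSeq X' Y'} {h : φ ⟶ full D (X ⨯ X')} {g : ψ ⟶ full D Y} {g' : ψ' ⟶ full D Y'}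
    {k : ψ' ⟶ full D Z} {S : D.Pred (Y' ⨯ Z)} (hS : Holds S g' k)
    (H : ProdDominated r t t' h (fullProd g g')) :
    ProdDominated r t (.cons S t') h (fullProd g k) := by
  obtain ⟨p, p', q, hp, hp', hq, H⟩ := H
  refine ⟨_, _, _, .insert_id hp, .cons S hp', .cons (D.idRel _) S hq, .skip ?_ H⟩
  exact holds_relProd.2 ⟨holds_idRel _, hS.comp _⟩

/-- Members dominating `s` and `s'` are matched in pairs, since these have equal length; the
additional members on either side are matched with identities. -/
theorem Dominated.prod {s : (sub D).RelSeq φ ψ} {t : D.RelSeq X Y} {h : φ ⟶ full D X}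
    {g : ψ ⟶ full D Y} (H : Dominated s t h g) {φ' ψ' : D.SyntS4} {X' Y' : C}
    {s' : (sub D).RelSeq φ' ψ'} {t' : D.RelSeq X' Y'} {h' : φ' ⟶ full D X'} {g' : ψ' ⟶ full D Y'}
    (H' : Dominated s' t' h' g') {r : (sub D).RelSeq (φ ⨯ φ') (ψ ⨯ ψ')}
    (hr : RelSeq.IsProd s s' r) : ProdDominated r t t' (fullProd h h') (fullProd g g') := by
  induction H generalizing φ' ψ' X' Y' with
  | nil h =>
    induction H' with
    | nil h' =>
      cases hr
      exact ⟨_, _, _, .nil _, .nil _, .nil _ _, .nil _⟩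
    | cons => cases hr
    | skip hS _ ih => exact .skip_right hS (ih hr)
  | cons hR H ih =>
    induction H' with
    | nil h' => cases hr
    | cons hR' H' =>
      cases hr with
      | cons _ _ hr =>
        obtain ⟨p, p', q, hp, hp', hq, H⟩ := ih H' hr
        exact ⟨_, _, _, .cons _ hp, .cons _ hp', .cons _ _ hq, .cons (hR.relProd hR') H⟩
    | skip hS _ ih' => exact .skip_right hS (ih' hr)
  | skip hS _ ih => exact .skip_left hS (ih H' hr)

/-- Embeddings compose, so `(d ≫ emb φ, t ≫ h)` is again the graph of a partial map; every element
of `f` factors through this graph. -/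
theorem exists_cont_contained {f : (sub D).Pred (φ ⨯ ψ)}
    (hf : f ∈ partialMaps D.surjections D.embeddings φ ψ) (h : ψ ⟶ full D Y) :
    ∃ R ∈ D.cont φ.obj.base Y, Contained f R (emb φ) h := by
  obtain ⟨α, d, t, i, hd, e⟩ := hf
  have hd' : D.embeddings (d ≫ emb φ) := by
    rw [embeddings_eq] at hd ⊢
    exact D.surjections.rlp.comp_mem _ _ hd (by rw [← embeddings_eq]; exact embeddings_emb _)
  obtain ⟨R, hR, H⟩ := exists_cont_holds hd' (t ≫ h)
  refine ⟨R, hR, fun {T} a b hab => ?_⟩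
  obtain ⟨j, hj⟩ := factors_iff_exists.1 (factors_iff_mem.2 hab)
  rw [← e] at hj
  have h₁ := congrArg (· ≫ prod.fst) hj
  have h₂ := congrArg (· ≫ prod.snd) hj
  simp only [Category.assoc, prod.lift_fst, prod.lift_snd] at h₁ h₂
  rw [← h₁, ← h₂]
  simpa only [Category.assoc] using H.comp (j ≫ i.hom)

/-- The inner loops of a conjugate or a product are dominated over the base objects of their own
anchors, then brought to `X` by a distinguished partial map. -/
theorem exists_acceptable {s : (sub D).RelSeq φ φ}
    (hs : s.Acceptable (partialMaps D.surjections D.embeddings)) {X : C} (h : φ ⟶ full D X)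
    (hh : D.embeddings h) :
    ∃ t : D.RelSeq X X, t.Acceptable D.cont ∧ Dominated s t h h := by
  induction hs generalizing X with
  | nil => exact ⟨.nil X, .nil X, .nil h⟩
  | insert_id s₁ s₂ _ ih =>
    obtain ⟨t, ht, H⟩ := ih h hh
    obtain ⟨Z, k, t₁, t₂, rfl, H₁, H₂⟩ := H.exists_of_append s₁ s₂ rfl
    exact ⟨_, .insert_id t₁ t₂ ht, H₁.append (.cons (contained_idRel k) H₂)⟩
  | append s₁ s₂ _ _ ih₁ ih₂ =>
    obtain ⟨t₁, ht₁, H₁⟩ := ih₁ h hh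
    obtain ⟨t₂, ht₂, H₂⟩ := ih₂ h hh
    exact ⟨_, .append t₁ t₂ ht₁ ht₂, H₁.append H₂⟩
  | @conj φ ψ f s hf _ ih =>
    obtain ⟨t, ht, H⟩ := ih (emb φ) (embeddings_emb φ)
    obtain ⟨R, hR, hfR⟩ := exists_cont_contained hf h
    exact ⟨_, .conj R t hR ht, .cons hfR (H.append (.cons hfR.conv (.nil h)))⟩
  | @prod φ ψ s₁ s₂ r _ _ hr ih₁ ih₂ =>
    obtain ⟨t₁, ht₁, H₁⟩ := ih₁ (emb φ) (embeddings_emb φ)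
    obtain ⟨t₂, ht₂, H₂⟩ := ih₂ (emb ψ) (embeddings_emb ψ)
    obtain ⟨p₁, p₂, q, hp₁, hp₂, hq, H⟩ := H₁.prod H₂ hr
    have hq' := RelSeq.Acceptable.prod (hp₁.acceptable (.nil _) ht₁)
      (hp₂.acceptable (.nil _) ht₂) hq
    -- The product loop lies over the product of the base objects, whereas `h` leads to `X`.
    -- Conjugation by the partial map with graph `(emb × emb, h)` connects the two, at the cost of
    -- two additional members.
    obtain ⟨R, hR, hRh⟩ := exists_cont_holds (embeddings_fullProd_emb φ ψ) h
    exact ⟨_, .conj R q hR hq', .skip hRh (H.append_of_holds (holds_conv.2 hRh))⟩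

theorem subDia_loopContraction :
    (sub D).LoopContraction (subDia D) (partialMaps D.surjections D.embeddings) := by
  intro φ s hs S
  obtain ⟨t, ht, H⟩ := exists_acceptable hs (emb φ) (embeddings_emb φ)
  -- For `h = emb φ`, membership is the same before and after composition, so domination compares
  -- the two sides of the axiom directly.
  have mem_emb : ∀ {T : D.SyntS4} (a : T ⟶ φ) (A : D.Pred φ.obj.base),
      Mem (φ := full D φ.obj.base) (a ≫ emb φ) A ↔ Mem a A := fun a A =>
    mem_comp_subIncl (φ := full D φ.obj.base) le_top
  rw [sub_le_iff]
  intro T a ha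
  rw [mem_und_subDia, ← mem_emb]
  exact (H.eval (fun b hb => (mem_emb b _).2 hb) a ha).mono (D.loop_contraction _ t ht _)

end Loops

end TopologicalModalDoctrine

end

theorem mainTheorem5 {C : Type u} [Category.{v} C] [HasFiniteProducts C]
    (D : TopologicalModalDoctrine.{w} C) :
    ∃ (_ : HasFiniteLimits D.SyntS4) (_ : IsFBoolean D.surjections D.embeddings)
      (e : ∀ φ : D.SyntS4, Set.Iic φ.obj.pred ≃o MSub D.embeddings φ),
      (∀ (X : C) (A B : D.Pred X) (h : A ≤ B),
        (e (TopologicalModalDoctrine.SyntS4.of D B) ⟨A, h⟩).1 =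
          Subobject.mk (TopologicalModalDoctrine.SyntS4.incl D h)) ∧
      IsTopologicalModalCategory D.surjections D.embeddings
        (fun φ S => e φ ⟨φ.obj.pred ⊓ D.dia φ.obj.base ((e φ).symm S).1, inf_le_left⟩) :=
  ⟨inferInstance, inferInstance, TopologicalModalDoctrine.subIso, fun _ _ _ _ => rfl,
    TopologicalModalDoctrine.isTopologicalModalCategory_of_loopContraction
      TopologicalModalDoctrine.subDia_loopContraction⟩
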